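/- **Setting.** An instance of the stable roommates problem with ties and incomplete lists (SRTI) is a finite set $N$ of agents in which each agent $a$ finds some of the other agents acceptable and ranks them by a weak order (total preorder). Write $b\succ_a c$ if $a$ strictly prefers $b$ to $c$; every acceptable candidate is preferred to being unmatched. A matching $M$ is a set of pairwise disjoint pairs of distinct agents, the two agents of a pair finding each other acceptable; $M(a)$ is the partner of $a$. A pair of agents $a,b$ that find each other acceptable, not matched to each other, blocks $M$ if each of the two is unmatched or strictly prefers the other to its partner; $M$ is stable if no pair blocks it. The size of $M$ is its number of pairs. Max SRTI is the problem of finding a stable matching of maximum size, or reporting that no stable matching exists. A *consistently-refined-typed* instance consists of the agents $N$, a number $k$ of types, the type of each agent, and, for each type $i$, a weak order $\succeq_i$ on a set of acceptable agents, such that for every type $i$: (a) type $i$ finds either all or none of the agents of a given type acceptable; (b) no agent of a different type is ranked by $\succeq_i$ strictly between two agents of the same type; (c) a tie of $\succeq_i$ that contains agents of two or more types is a union of types. An agent $a$ of type $i$ has the preference list $\succeq_i$ with $a$ itself deleted. Type $i$ prefers type $j$ to type $\ell$ if $x\succ_i y$ for all agents $x$ of type $j$ and $y$ of type $\ell$.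 A *typed* instance consists of the agents, the types and, for each type $i$, a weak order $\succeq_i$ on a set of acceptable types; agents rank the other agents by their types and are indifferent between agents of the same type. *Preferences over types are strict* if, for every type $i$ and any two distinct types $j,\ell$ acceptable to $i$, type $i$ prefers $j$ to $\ell$ or prefers $\ell$ to $j$. Typed Max SRTI and Consistently-Refined-Typed Max SRTI are Max SRTI restricted to such instances. The input consists of the number of agents, the number $k$ of types, the type of each agent and, for each type $i$, the order $\succeq_i$ over types, respectively over agents, given by the rank of every candidate ($0$ if unacceptable, otherwise one plus the number of candidates strictly preferred to it). Polynomial time is measured on a random access machine with addition and truncated subtraction at unit cost, in the bit length of the input. **Theorem.** When preferences over types are strict, Typed Max SRTI and Consistently-Refined-Typed Max SRTI are solvable in polynomial time. Moreover, in every typed or consistently-refined-typed instance with strict preferences over types, all stable matchings (if any exist) have the same size. -/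

import Mathlib

/-! ### Preference lists, stable roommates with ties and incomplete lists -/

/-- A preference list over candidates `C`, possibly incomplete and possibly with ties: the
acceptable candidates, and a weak order (total preorder) on them.  `wpref b c` is read
"`b` is weakly preferred to `c`" and is only meaningful for acceptable `b` and `c`. -/
structure Pref (C : Type*) where
  acc : C → Prop
  wpref : C → C → Prop
  total : ∀ b c, acc b → acc c → wpref b c ∨ wpref c b
  trans : ∀ b c d, acc b → acc c → acc d → wpref b c → wpref c d → wpref b d

namespace Pref

variable {C D : Type*}

/-- Strict preference between acceptable candidates. -/
def strict (P : Pref C) (b c : C) : Prop := P.acc b ∧ P.acc c ∧ ¬ P.wpref c b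

/-- Indifference between acceptable candidates: `b` and `c` belong to the same tie. -/
def indiff (P : Pref C) (b c : C) : Prop := P.acc b ∧ P.acc c ∧ P.wpref b c ∧ P.wpref c b

/-- Pull back a preference list along `f`: candidates are compared through their images. -/
def comap (f : D → C) (P : Pref C) : Pref D where
  acc b := P.acc (f b)
  wpref b c := P.wpref (f b) (f c)
  total b c := P.total (f b) (f c)
  trans b c d := P.trans (f b) (f c) (f d)

/-- Delete the candidate `a` from a preference list. -/
def erase (P : Pref C) (a : C) : Pref C where
  acc b := b ≠ a ∧ P.acc b
  wpref := P.wpref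
  total b c hb hc := P.total b c hb.2 hc.2
  trans b c d hb hc hd := P.trans b c d hb.2 hc.2 hd.2

open Classical in
/-- The rank of a candidate: one plus the number of candidates that are strictly preferred to it;
`0` stands for an unacceptable candidate. -/
noncomputable def rank (P : Pref C) (b : C) : ℕ :=
  if P.acc b then 1 + {c | P.strict c b}.ncard else 0

end Pref

/-- An instance of the stable roommates problem with ties and incomplete lists, with agents `A`:
every agent has a preference list over the other agents. -/
structure SRTI (A : Type*) where
  pref : A → Pref A
  not_acc_self : ∀ a, ¬ (pref a).acc a

namespace SRTI

variable {A : Type*}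

/-- A matching, given by its partner function (`M a = none` if `a` is unmatched). -/
structure IsMatching (I : SRTI A) (M : A → Option A) : Prop where
  symm : ∀ a b, M a = some b → M b = some a
  acc : ∀ a b, M a = some b → (I.pref a).acc b

/-- Agent `a` prefers `b` to the situation of `a` in `M`; every acceptable candidate is preferred
to being unmatched. -/
def PrefersToPartner (I : SRTI A) (M : A → Option A) (a b : A) : Prop :=
  (I.pref a).acc b ∧ ∀ c, M a = some c → (I.pref a).strict b c

/-- The pair `(a, b)` blocks `M`. -/
def Blocks (I : SRTI A) (M : A → Option A) (a b : A) : Prop :=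
  M a ≠ some b ∧ I.PrefersToPartner M a b ∧ I.PrefersToPartner M b a

/-- (Weak) stability. -/
def IsStable (I : SRTI A) (M : A → Option A) : Prop :=
  I.IsMatching M ∧ ∀ a b, ¬ I.Blocks M a b

end SRTI

/-- The number of (unordered) pairs of a matching. -/
noncomputable def matchingSize {A : Type*} (M : A → Option A) : ℕ :=
  {e : Sym2 A | ∃ a b, M a = some b ∧ e = s(a, b)}.ncard

/-- A maximum cardinality stable matching. -/
def SRTI.IsMaxStable {A : Type*} (I : SRTI A) (M : A → Option A) : Prop :=
  I.IsStable M ∧ ∀ M', I.IsStable M' → matchingSize M' ≤ matchingSize M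

/-! ### Typed and consistently-refined-typed instances -/

/-- A consistently-refined-typed instance with agents `A` and types `T`: the type of every agent
and, for every type `i`, one preference list over agents, shared by all agents of type `i`
(an agent does not rank itself).  A type finds all or none of the agents of a type acceptable,
agents of the same type occur consecutively, and a tie that contains agents of at least
two types is a union of types. -/
structure RefinedTypedInstance (A T : Type*) where
  typ : A → T
  pref : T → Pref A
  acc_congr : ∀ i x y, typ x = typ y → (pref i).acc x → (pref i).acc y
  consecutive : ∀ i x y z, typ x = typ y → typ z ≠ typ x →
    ¬ ((pref i).strict x z ∧ (pref i).strict z y)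
  tie_union : ∀ i x y z, typ x = typ y → typ z ≠ typ x →
    (pref i).indiff x z → (pref i).indiff y z

namespace RefinedTypedInstance

variable {A T : Type*}

/-- The underlying instance: an agent of type `i` has the list of type `i`, itself deleted. -/
def toSRTI (I : RefinedTypedInstance A T) : SRTI A where
  pref a := (I.pref (I.typ a)).erase a
  not_acc_self _ h := h.1 rfl

/-- Type `i` finds type `j` acceptable. -/
def AccType (I : RefinedTypedInstance A T) (i j : T) : Prop :=
  ∃ x, I.typ x = j ∧ (I.pref i).acc x

/-- Type `i` (strictly) prefers type `j` to type `l`. -/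
def PrefersType (I : RefinedTypedInstance A T) (i j l : T) : Prop :=
  ∀ x y, I.typ x = j → I.typ y = l → (I.pref i).strict x y

/-- The preferences over types are strict. -/
def StrictOverTypes (I : RefinedTypedInstance A T) : Prop :=
  ∀ i j l, j ≠ l → I.AccType i j → I.AccType i l → I.PrefersType i j l ∨ I.PrefersType i l j

end RefinedTypedInstance

/-- A typed instance with agents `A` and types `T`: the type of every agent and, for every type,
a preference list over types. -/
structure TypedInstance (A T : Type*) where
  typ : A → T
  pref : T → Pref T

namespace TypedInstance

variable {A T : Type*}

/-- A typed instance is the consistently-refined-typed instance in which all agents are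
indifferent between the agents of one type. -/
def toRefined (I : TypedInstance A T) : RefinedTypedInstance A T where
  typ := I.typ
  pref i := (I.pref i).comap I.typ
  acc_congr i x y h := by simp [Pref.comap, h]
  consecutive i x y z h _ := by
    simp only [Pref.comap, Pref.strict, h]
    rintro ⟨⟨h1, h2, h3⟩, _, _, h4⟩
    exact (((I.pref i).total _ _ h1 h2).elim h4 h3)
  tie_union i x y z h _ := by simp [Pref.comap, Pref.indiff, h]

/-- The underlying instance. -/
def toSRTI (I : TypedInstance A T) : SRTI A := I.toRefined.toSRTI

/-- The preferences over types are strict. -/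
def StrictOverTypes (I : TypedInstance A T) : Prop :=
  ∀ i j l, j ≠ l → (I.pref i).acc j → (I.pref i).acc l →
    (I.pref i).strict j l ∨ (I.pref i).strict l j

end TypedInstance

/-! ### Random access machines and polynomial time

Programs are while-programs over a random access memory of natural numbers, with constants,
addition and truncated subtraction as the only arithmetic.  Every arithmetic operation, every
memory access, every assignment and every test costs one time unit.  As there is no unit-cost
multiplication, this is polynomially equivalent to Turing machines. -/

namespace RAM

/-- The memory: finitely many banks are named by a program (the first index), each of them is an
infinite array of cells (the second index). -/
abbrev Store : Type := ℕ → ℕ → ℕ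

/-- Write `v` to the cell `i` of the bank `b`. -/
def Store.write (s : Store) (b i v : ℕ) : Store := Function.update s b (Function.update (s b) i v)

/-- Arithmetic terms; `cell b e` is the content of the cell of bank `b` whose address is `e`. -/
inductive Term : Type
  | const (v : ℕ)
  | cell (b : ℕ) (e : Term)
  | add (e f : Term)
  | sub (e f : Term)

/-- The value of a term (`sub` is truncated subtraction). -/
def Term.eval (s : Store) : Term → ℕ
  | const v => v
  | cell b e => s b (e.eval s)
  | add e f => e.eval s + f.eval s
  | sub e f => e.eval s - f.eval s

/-- The time to evaluate a term. -/
def Term.cost : Term → ℕ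
  | const _ => 1
  | cell _ e => e.cost + 1
  | add e f => e.cost + f.cost + 1
  | sub e f => e.cost + f.cost + 1

/-- Programs.  `assign b e f` writes the value of `f` to the cell of bank `b` with address `e`. -/
inductive Program : Type
  | skip
  | assign (b : ℕ) (e f : Term)
  | seq (p q : Program)
  | ite (e : Term) (p q : Program)
  | loop (e : Term) (p : Program)

/-- `Exec p s s' t`: the program `p`, started in `s`, terminates in `s'` after `t` time units.
A test succeeds if its value is not `0`; `loop e p` is "while `e` do `p`". -/
inductive Exec : Program → Store → Store → ℕ → Prop
  | skip (s) : Exec .skip s s 1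
  | assign (b e f s) :
      Exec (.assign b e f) s (s.write b (e.eval s) (f.eval s)) (e.cost + f.cost + 1)
  | seq {p q s s' s'' t t'} :
      Exec p s s' t → Exec q s' s'' t' → Exec (.seq p q) s s'' (t + t')
  | ite_true {e p q s s' t} :
      e.eval s ≠ 0 → Exec p s s' t → Exec (.ite e p q) s s' (e.cost + 1 + t)
  | ite_false {e p q s s' t} :
      e.eval s = 0 → Exec q s s' t → Exec (.ite e p q) s s' (e.cost + 1 + t)
  | loop_stop {e p s} :
      e.eval s = 0 → Exec (.loop e p) s s (e.cost + 1)
  | loop_step {e p s s' s'' t t'} :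
      e.eval s ≠ 0 → Exec p s s' t → Exec (.loop e p) s' s'' t' →
      Exec (.loop e p) s s'' (e.cost + 1 + t + t')

/-- The initial memory: the input word is in the cells `1, 2, …` of bank `0`, its length is in
cell `0` of bank `0`, and all other cells contain `0`. -/
def initStore (w : List ℕ) : Store := fun b i => if b = 0 then (w.length :: w).getD i 0 else 0

/-- The output word: its length is in cell `0` of bank `1`, its letters in the cells `1, 2, …`. -/
def output (s : Store) : List ℕ := (List.range (s 1 0)).map fun i => s 1 (i + 1)

/-- The size of an input word: the number of its letters plus their total binary length. -/
def inputSize (w : List ℕ) : ℕ := (w.map fun v => v.size + 1).sum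

/-- The search problem "given the encoding of an instance `x` that satisfies `Dom`, compute a word
`v` with `Sol x v`" is solvable in polynomial time. -/
def PolyTimeSolvable {X : Type*} (Dom : X → Prop) (encode : X → List ℕ)
    (Sol : X → List ℕ → Prop) : Prop :=
  ∃ (p : Program) (P : Polynomial ℕ), ∀ x, Dom x →
    ∃ s t, Exec p (initStore (encode x)) s t ∧ t ≤ P.eval (inputSize (encode x)) ∧
      Sol x (output s)

end RAM

/-! ### The computational problems -/

/-- A word answers the problem to find a maximum cardinality stable matching of `I` or to report
that there is no stable matching: the report is the word `0`; a matching `M` is written as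
`1, m₀, …, mₙ₋₁` where `mₐ = M a + 1` if `a` is matched and `mₐ = 0` otherwise. -/
def SRTI.IsMaxStableAnswer {n : ℕ} (I : SRTI (Fin n)) (v : List ℕ) : Prop :=
  (∃ M, I.IsMaxStable M ∧
    v = 1 :: List.ofFn fun a => (M a).elim 0 fun b => (b : ℕ) + 1) ∨
  ((∀ M, ¬ I.IsStable M) ∧ v = [0])

/-- An input of the problem for typed instances. -/
structure TypedInput where
  n : ℕ
  k : ℕ
  inst : TypedInstance (Fin n) (Fin k)

/-- The input word: `n`, `k`, the types of the agents, and for every type the ranks of all types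
in its list. -/
noncomputable def TypedInput.encode (x : TypedInput) : List ℕ :=
  x.n :: x.k :: ((List.ofFn fun a => (x.inst.typ a : ℕ)) ++
    (List.ofFn fun i => List.ofFn fun j => (x.inst.pref i).rank j).flatten)

/-- An input of the problem for consistently-refined-typed instances. -/
structure RefinedTypedInput where
  n : ℕ
  k : ℕ
  inst : RefinedTypedInstance (Fin n) (Fin k)

/-- The input word: `n`, `k`, the types of the agents, and for every type the ranks of all agents
in its list. -/
noncomputable def RefinedTypedInput.encode (x : RefinedTypedInput) : List ℕ :=
  x.n :: x.k :: ((List.ofFn fun a => (x.inst.typ a : ℕ)) ++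
    (List.ofFn fun i => List.ofFn fun a => (x.inst.pref i).rank a).flatten)

/-! ### Stable involutions for strict ranks -/

namespace StrictRoommates

variable {A : Type*}

/-! Break all ties, say by index, and insert every agent into its own list right after the
acceptable candidates. This yields a roommates problem with strict ranks in which an unmatched agent
is matched to itself. An involution that is stable for the strict ranks is stable for the original
lists, because a pair that blocks in the presence of ties also blocks after the refinement
(`BreaksTies.isStable_partnerOf`).

The converse needs strictness over types. In a stable matching no pair blocks because of types
alone, and this property survives the exchange of two agents of one type. If a pair `a`, `b` blocks
in the refinement, then one of them, say `a`, gains only within a type: `b` and the partner of `a`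
have the same type. Exchanging these two strictly lowers a lexicographic potential
(`potential_exchange_lt`), so a minimiser of the potential is stable in the refinement, with as many
unmatched agents as before (`StableByType.exists_stableByRank`). All stable involutions for strict
ranks have the same fixed points (`Stable.fixed_of_fixed`), hence all stable matchings have the same
size, and any stable matching of the refinement is an answer.

The strict problem is solved with upper bounds on the ranks of the partners, kept such that some
stable involution obeys them if there is one at all. The bound of one agent is lowered by one
tentatively, and proposals are made until nothing changes. If some lower bound then exceeds the
upper bound, the old bound was tight. Otherwise the outcome is a `Table`, and `Table.exists_stable`
moves any stable involution into it, so the new bounds may be kept. Once all bounds are tight they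
determine a single candidate, which is checked directly.

The program only uses loops whose number of rounds is the length of the input word, so its running
time is polynomial by its syntax (`RAM.Cmd.WF.exec`). -/

/-- An involution `m` (fixed points are the unmatched agents) without blocking pairs, where
`R x y` is the rank of `y` for `x`; a pair `(x, x)` expresses individual rationality. -/
structure Stable (R : A → A → ℕ) (m : A → A) : Prop where
  invol : ∀ x, m (m x) = x
  not_blocks : ∀ x y, ¬ (R x y < R x (m x) ∧ R y x < R y (m y))

/-- An agent that is better off in `m` than in `m'` has an `m`-partner that is worse off, for
otherwise the two block `m'`; the same holds with the roles reversed. Counting shows that `m'` maps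
the agents preferring `m'` onto those preferring `m`. An agent fixed by `m'` alone prefers `m`, but
as its own `m'`-partner it would also have to prefer `m'`. -/
theorem Stable.fixed_of_fixed [Finite A] {R : A → A → ℕ} (hR : ∀ x, Function.Injective (R x))
    {m m' : A → A} (h : Stable R m) (h' : Stable R m') {x : A} (hx : m' x = x) : m x = x := by
  classical
  have := Fintype.ofFinite A
  by_contra hne
  let X : Finset A := Finset.univ.filter fun x => R x (m x) < R x (m' x)
  let Y : Finset A := Finset.univ.filter fun x => R x (m' x) < R x (m x)
  have hXY : ∀ x ∈ X, m x ∈ Y := by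
    intro x hx
    simp only [X, Y, Finset.mem_filter, Finset.mem_univ, true_and, h.invol] at hx ⊢
    have h1 := h'.not_blocks x (m x)
    rcases lt_trichotomy (R (m x) (m' (m x))) (R (m x) x) with h2 | h2 | h2
    · exact h2
    · have h3 := hR _ h2
      rw [← h3, h'.invol, h3] at hx
      exact absurd hx (lt_irrefl _)
    · exact absurd ⟨hx, h2⟩ h1
  have hYX : ∀ y ∈ Y, m' y ∈ X := by
    intro x hx
    simp only [X, Y, Finset.mem_filter, Finset.mem_univ, true_and, h'.invol] at hx ⊢
    have h1 := h.not_blocks x (m' x)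
    rcases lt_trichotomy (R (m' x) (m (m' x))) (R (m' x) x) with h2 | h2 | h2
    · exact h2
    · have h3 := hR _ h2
      rw [← h3, h.invol, h3] at hx
      exact absurd hx (lt_irrefl _)
    · exact absurd ⟨hx, h2⟩ h1
  have inj : Function.Injective m := fun a b e => by rw [← h.invol a, e, h.invol]
  have inj' : Function.Injective m' := fun a b e => by rw [← h'.invol a, e, h'.invol]
  have c1 : X.card ≤ Y.card := Finset.card_le_card_of_injOn m hXY inj.injOn
  have hxX : x ∈ X := by
    simp only [X, Finset.mem_filter, Finset.mem_univ, true_and, hx]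
    refine lt_of_le_of_ne ?_ fun e => hne (hR _ e)
    by_contra hlt
    exact h.not_blocks x x ⟨not_le.1 hlt, not_le.1 hlt⟩
  have himg : Y.image m' = X := Finset.eq_of_subset_of_card_le
    (Finset.image_subset_iff.2 hYX) (by rwa [Finset.card_image_of_injective _ inj'])
  rw [← himg] at hxX
  obtain ⟨y, hy, hyx⟩ := Finset.mem_image.1 hxX
  have : y = x := by rw [← h'.invol y, hyx, hx]
  subst this
  have := hYX _ hy
  simp only [X, Y, Finset.mem_filter, Finset.mem_univ, true_and, hx] at hy this
  omega

/-! ### Tables of rank bounds and the stable involutions inside them -/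

/-- The best candidate that is left for `x` has rank at least `u x`, the worst one has rank at most
`r x`; every agent `x` has been refused by all candidates of rank less than `u x`. -/
structure Table (R : A → A → ℕ) (u r : A → ℕ) : Prop where
  refused : ∀ x y, R x y < u x → r y < R y x
  fixed : ∀ x y, R x y = u x → r y = R y x
  valid : ∀ x, u x ≤ r x

/-- Agents above their first remaining choice in `m` and agents below their last one are put in
bijection both by `m` and by the first-to-last-choice map. Hence the former can be moved down to
their first choices and the latter up to their last choices, and the result is again a stable
involution. -/
theorem Table.exists_stable [Finite A] {R : A → A → ℕ} (hR : ∀ x, Function.Injective (R x))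
    {u r : A → ℕ} (hT : Table R u r) (hu : ∀ x, ∃ y, R x y = u x) {m : A → A} (h : Stable R m) :
    ∃ m', Stable R m' ∧ ∀ x, R x (m' x) ≤ r x := by
  classical
  have := Fintype.ofFinite A
  choose f hf using hu
  have hfr : ∀ x, R (f x) x = r (f x) := fun x => (hT.fixed x _ (hf x)).symm
  -- The last choice of the first choice of `x` is `x` itself, so first choices are distinct; the
  -- inverse `l` of `f` gives the last choices.
  have finj : Function.Injective f := fun a b e => hR (f a) (by rw [hfr, e, hfr])
  have fbij : Function.Bijective f := Finite.injective_iff_bijective.1 finj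
  obtain ⟨l, hlf, hfl⟩ := Function.bijective_iff_has_inverse.1 fbij
  have hl : ∀ y, R y (l y) = r y := fun y => by have := hfr (l y); rwa [hfl] at this
  have inj : Function.Injective m := fun a b e => by rw [← h.invol a, e, h.invol]
  have linj : Function.Injective l := hfl.injective
  let X : Finset A := Finset.univ.filter fun x => R x (m x) < u x
  let Y : Finset A := Finset.univ.filter fun x => r x < R x (m x)
  have memX : ∀ x, x ∈ X ↔ R x (m x) < u x := by simp [X]
  have memY : ∀ x, x ∈ Y ↔ r x < R x (m x) := by simp [Y]
  have hXY : ∀ x ∈ X, m x ∈ Y := by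
    intro x hx
    rw [memX] at hx
    rw [memY, h.invol]
    exact hT.refused _ _ hx
  have hYX : ∀ y ∈ Y, l y ∈ X := by
    intro y hy
    rw [memY] at hy
    rw [memX]
    have h2 := h.not_blocks (l y) y
    have h3 : R (l y) y = u (l y) := by rw [← hf (l y), hfl]
    rw [hl] at h2
    refine lt_of_le_of_ne (by omega) fun e => ?_
    have h4 : m (l y) = y := hR _ (e.trans h3.symm)
    have h5 : m y = l y := by rw [← h4, h.invol, h4]
    rw [h5, hl] at hy
    exact lt_irrefl _ hy
  have c1 : X.card ≤ Y.card := Finset.card_le_card_of_injOn m hXY inj.injOn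
  have c2 : Y.card ≤ X.card := Finset.card_le_card_of_injOn l hYX linj.injOn
  have himg : Y.image l = X := Finset.eq_of_subset_of_card_le
    (Finset.image_subset_iff.2 hYX) (by rwa [Finset.card_image_of_injective _ linj])
  have himg' : X.image m = Y := Finset.eq_of_subset_of_card_le
    (Finset.image_subset_iff.2 hXY) (by rwa [Finset.card_image_of_injective _ inj])
  have hfXY : ∀ x ∈ X, f x ∈ Y := by
    intro x hx
    rw [← himg] at hx
    obtain ⟨y, hy, rfl⟩ := Finset.mem_image.1 hx
    rwa [hfl]
  have hmYX : ∀ y ∈ Y, m y ∈ X := by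
    intro y hy
    rw [← himg'] at hy
    obtain ⟨x, hx, rfl⟩ := Finset.mem_image.1 hy
    rwa [h.invol]
  have disj : ∀ x, x ∈ X → x ∉ Y := by
    intro x h1 h2
    rw [memX] at h1
    rw [memY] at h2
    have := hT.valid x
    omega
  let m' : A → A := fun x => if x ∈ X then f x else if x ∈ Y then l x else m x
  have mX : ∀ x, x ∈ X → m' x = f x := fun x hx => by simp [m', hx]
  have mY : ∀ x, x ∈ Y → m' x = l x := fun x hx => by
    have : x ∉ X := fun h => disj x h hx
    simp [m', hx, this]
  have mN : ∀ x, x ∉ X → x ∉ Y → m' x = m x := fun x hx hy => by simp [m', hx, hy]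
  have hle : ∀ x, R x (m' x) ≤ r x := by
    intro x
    by_cases hx : x ∈ X
    · rw [mX x hx, hf]; exact hT.valid x
    by_cases hy : x ∈ Y
    · rw [mY x hy, hl]
    · rw [mN x hx hy]; rw [memY] at hy; omega
  refine ⟨m', ⟨fun x => ?_, ?_⟩, hle⟩
  · by_cases hx : x ∈ X
    · rw [mX x hx, mY _ (hfXY x hx), hlf]
    by_cases hy : x ∈ Y
    · rw [mY x hy, mX _ (hYX x hy), hfl]
    · rw [mN x hx hy, mN, h.invol]
      · intro h1; have := hXY _ h1; rw [h.invol] at this; exact hy this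
      · intro h1; have := hmYX _ h1; rw [h.invol] at this; exact hx this
  · rintro x y ⟨h1, h2⟩
    -- A member of a blocking pair of `m'` is not in `X`: it would have been refused by the other
    -- one. Outside `X` the new partner is no worse than the old one, so the pair would block `m`
    -- already.
    have key : ∀ x y, R x y < R x (m' x) → R y x < R y (m' y) → R x (m' x) ≤ R x (m x) := by
      intro x y h1 h2
      have hxX : x ∉ X := by
        intro hx
        rw [mX x hx, hf] at h1
        have := hT.refused _ _ h1
        have := hle y
        omega
      by_cases hy : x ∈ Y
      · rw [mY x hy, hl]; rw [memY] at hy; omega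
      · rw [mN x hxX hy]
    exact h.not_blocks x y ⟨h1.trans_le (key x y h1 h2), h2.trans_le (key y x h2 h1)⟩

/-! ### Proposals -/

/-- If `y` is the best candidate left for `x`, then `x` proposes to `y`: either `y` discards all
candidates worse than `x`, or `y` refuses. -/
def propose [DecidableEq A] (R : A → A → ℕ) (x y : A) (p : (A → ℕ) × (A → ℕ)) : (A → ℕ) × (A → ℕ) :=
  if R x y = p.1 x then
    if R y x ≤ p.2 y then (p.1, Function.update p.2 y (R y x))
    else (Function.update p.1 x (p.1 x + 1), p.2)
  else p

/-- What holds after any sequence of proposals that starts with `u = 0` and `r = r₀`. -/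
structure Reached (R : A → A → ℕ) (n : ℕ) (r₀ : A → ℕ) (p : (A → ℕ) × (A → ℕ)) : Prop where
  refused : ∀ x y, R x y < p.1 x → p.2 y < R y x
  le : ∀ x, p.2 x ≤ r₀ x
  le_card : ∀ x, p.1 x ≤ n
  sound : ∀ m, Stable R m → (∀ x, R x (m x) ≤ r₀ x) →
    ∀ x, p.1 x ≤ R x (m x) ∧ R x (m x) ≤ p.2 x

theorem Reached.init (R : A → A → ℕ) (n : ℕ) (r₀ : A → ℕ) : Reached R n r₀ (fun _ => 0, r₀) :=
  ⟨fun _ _ h => absurd h (Nat.not_lt_zero _), fun _ => le_rfl, fun _ => Nat.zero_le _,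
    fun _ _ h x => ⟨Nat.zero_le _, h x⟩⟩

/-- In a stable `m` within the bounds, `x` gets nothing better than the proposed `y`. So `y` cannot
end up worse than `x` without blocking, which justifies lowering the bound of `y`. If the bound of
`y` already excludes `x`, then `y` is not the partner of `x`, which justifies raising the bound of
`x`. -/
theorem Reached.propose [DecidableEq A] {R : A → A → ℕ} (hR : ∀ x, Function.Injective (R x)) {n : ℕ}
    (hn : ∀ x y, R x y < n) {r₀ : A → ℕ} {p : (A → ℕ) × (A → ℕ)} (h : Reached R n r₀ p) (x y : A) :
    Reached R n r₀ (propose R x y p) := by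
  unfold StrictRoommates.propose
  split_ifs with h1 h2
  · refine ⟨fun a b hab => ?_, fun a => ?_, h.le_card, fun m hm hr a => ?_⟩
    · have := h.refused a b hab
      dsimp only
      by_cases hb : b = y
      · subst hb; rw [Function.update_self]; omega
      · rwa [Function.update_of_ne hb]
    · have := h.le a
      dsimp only
      by_cases hb : a = y
      · subst hb; rw [Function.update_self]; omega
      · rwa [Function.update_of_ne hb]
    · have := h.sound m hm hr a
      dsimp only
      by_cases hb : a = y
      · subst hb
        rw [Function.update_self]
        refine ⟨this.1, ?_⟩
        have h3 := hm.not_blocks x a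
        have h4 := (h.sound m hm hr x).1
        rcases lt_or_eq_of_le h4 with h5 | h5
        · omega
        · have h6 : m x = a := hR _ (h5.symm.trans h1.symm)
          rw [← h6, hm.invol]
      · rwa [Function.update_of_ne hb]
  · refine ⟨fun a b hab => ?_, h.le, fun a => ?_, fun m hm hr a => ?_⟩
    · dsimp only at hab ⊢
      by_cases hb : a = x
      · subst hb
        rw [Function.update_self] at hab
        rcases Nat.lt_succ_iff_lt_or_eq.1 hab with h3 | h3
        · exact h.refused _ _ h3
        · have h4 : b = y := hR _ (h3.trans h1.symm)
          subst h4
          omega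
      · rw [Function.update_of_ne hb] at hab
        exact h.refused _ _ hab
    · dsimp only
      by_cases hb : a = x
      · subst hb; rw [Function.update_self]; have := hn a y; omega
      · rw [Function.update_of_ne hb]; exact h.le_card a
    · have := h.sound m hm hr a
      dsimp only
      by_cases hb : a = x
      · subst hb
        rw [Function.update_self]
        refine ⟨Nat.lt_of_le_of_ne this.1 fun e => ?_, this.2⟩
        have h6 : m a = y := hR _ (e.symm.trans h1.symm)
        have := (h.sound m hm hr y).2
        rw [← h6, hm.invol, h6] at this
        exact h2 this
      · rwa [Function.update_of_ne hb]
  · exact h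

/-- The number of steps that have been made. -/
def progress [Fintype A] (n : ℕ) (p : (A → ℕ) × (A → ℕ)) : ℕ :=
  ∑ x, p.1 x + ∑ x, (n - p.2 x)

/-- Lower bounds only rise and upper bounds only fall. The hypothesis `hp` makes every decrease of
an upper bound visible in the truncated difference. -/
theorem progress_propose [Fintype A] [DecidableEq A] {R : A → A → ℕ} {n : ℕ} {p : (A → ℕ) × (A → ℕ)}
    (hp : ∀ x, p.2 x ≤ n) (x y : A) :
    propose R x y p = p ∨ progress n p < progress n (propose R x y p) := by
  unfold propose
  split_ifs with h1 h2
  · rcases Nat.lt_or_eq_of_le h2 with h3 | h3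
    · right
      unfold progress
      refine Nat.add_lt_add_left (Finset.sum_lt_sum (fun a _ => ?_) ⟨y, Finset.mem_univ _, ?_⟩) _
      · dsimp only
        by_cases hb : a = y
        · subst hb; rw [Function.update_self]; omega
        · rw [Function.update_of_ne hb]
      · dsimp only
        rw [Function.update_self]
        have := hp y
        omega
    · left
      rw [h3, Function.update_eq_self]
  · right
    unfold progress
    refine Nat.add_lt_add_right (Finset.sum_lt_sum (fun a _ => ?_) ⟨x, Finset.mem_univ _, ?_⟩) _
    · dsimp only
      by_cases hb : a = x
      · subst hb; rw [Function.update_self]; omega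
      · rw [Function.update_of_ne hb]
    · dsimp only
      rw [Function.update_self]
      omega
  · left; rfl

theorem Reached.progress_le [Fintype A] {R : A → A → ℕ} {n : ℕ} {r₀ : A → ℕ}
    {p : (A → ℕ) × (A → ℕ)} (h : Reached R n r₀ p) :
    progress n p ≤ Fintype.card A * n + Fintype.card A * n := by
  unfold progress
  refine Nat.add_le_add ?_ ?_
  · simpa using Finset.sum_le_card_nsmul Finset.univ p.1 n fun x _ => h.le_card x
  · simpa using Finset.sum_le_card_nsmul Finset.univ (fun x => n - p.2 x) n
      fun x _ => Nat.sub_le _ _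

/-- At a fixed point a refusal is impossible, as it would raise a lower bound; so the proposal is
accepted, and acceptance changes nothing only if the upper bound already is the rank of the
proposer. -/
theorem Reached.table [DecidableEq A] {R : A → A → ℕ} {n : ℕ} {r₀ : A → ℕ} {p : (A → ℕ) × (A → ℕ)}
    (h : Reached R n r₀ p) (hp : ∀ x y, StrictRoommates.propose R x y p = p)
    (hv : ∀ x, p.1 x ≤ p.2 x) : Table R p.1 p.2 := by
  refine ⟨h.refused, fun x y hxy => ?_, hv⟩
  have h1 := hp x y
  unfold StrictRoommates.propose at h1
  rw [if_pos hxy] at h1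
  split_ifs at h1 with h2
  · have := congrFun (congrArg Prod.snd h1) y
    dsimp only at this
    rw [Function.update_self] at this
    exact this.symm
  · have := congrFun (congrArg Prod.fst h1) x
    dsimp only at this
    rw [Function.update_self] at this
    omega

end StrictRoommates

/-! ### Refining the ties of a typed instance -/

theorem Pref.strict_trans {C : Type*} (P : Pref C) {b c d : C} (h : P.strict b c)
    (h' : P.strict c d) : P.strict b d :=
  ⟨h.1, h'.2.1, fun hw => h'.2.2
    (P.trans d b c h'.2.1 h.1 h.2.1 hw ((P.total b c h.1 h.2.1).resolve_right h.2.2))⟩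

theorem Pref.not_strict_self {C : Type*} (P : Pref C) (b : C) : ¬ P.strict b b :=
  fun h => h.2.2 ((P.total b b h.1 h.1).elim id id)

namespace RefinedTypedInstance

variable {A T : Type*}

/-- An involution that matches acceptable agents; its fixed points are the unmatched agents. -/
structure IsPairing (I : RefinedTypedInstance A T) (m : A → A) : Prop where
  invol : ∀ a, m (m a) = a
  acc : ∀ a, m a ≠ a → (I.pref (I.typ a)).acc (m a)

/-- Agent `a` prefers `b` to its situation in `m`, only because of the types. -/
def PrefersByType (I : RefinedTypedInstance A T) (m : A → A) (a b : A) : Prop :=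
  (I.pref (I.typ a)).acc b ∧ (m a ≠ a → I.PrefersType (I.typ a) (I.typ b) (I.typ (m a)))

/-- No pair blocks `m` only because of the types. -/
structure StableByType (I : RefinedTypedInstance A T) (m : A → A) : Prop extends
    I.IsPairing m where
  not_blocks : ∀ a b, a ≠ b → ¬ (I.PrefersByType m a b ∧ I.PrefersByType m b a)

/-- Agent `a` prefers `b` to its situation in `m`, when type `i` orders the agents by `ρ i`. -/
def PrefersByRank (I : RefinedTypedInstance A T) (ρ : T → A → ℕ) (m : A → A) (a b : A) : Prop :=
  (I.pref (I.typ a)).acc b ∧ (m a ≠ a → ρ (I.typ a) b < ρ (I.typ a) (m a))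

/-- No pair blocks `m`, when type `i` orders the agents by `ρ i`. -/
structure StableByRank (I : RefinedTypedInstance A T) (ρ : T → A → ℕ) (m : A → A) : Prop extends
    I.IsPairing m where
  not_blocks : ∀ a b, a ≠ b → ¬ (I.PrefersByRank ρ m a b ∧ I.PrefersByRank ρ m b a)

theorem acc_iff_of_typ_eq (I : RefinedTypedInstance A T) {i : T} {x y : A}
    (h : I.typ x = I.typ y) : (I.pref i).acc x ↔ (I.pref i).acc y :=
  ⟨I.acc_congr i x y h, I.acc_congr i y x h.symm⟩

/-! ### Exchanging two agents of the same type -/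

section Swap

variable [DecidableEq A]

/-- Exchange the roles of `b` and `b'` in `m`. -/
def exchange (b b' : A) (m : A → A) : A → A :=
  fun x => Equiv.swap b b' (m (Equiv.swap b b' x))

variable {I : RefinedTypedInstance A T} {b b' : A}

theorem typ_swap (hb : I.typ b = I.typ b') (x : A) : I.typ (Equiv.swap b b' x) = I.typ x := by
  rcases eq_or_ne x b with rfl | h1
  · rw [Equiv.swap_apply_left, hb]
  rcases eq_or_ne x b' with rfl | h2
  · rw [Equiv.swap_apply_right, hb]
  · rw [Equiv.swap_apply_of_ne_of_ne h1 h2]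

theorem exchange_eq_self_iff {m : A → A} (x : A) :
    exchange b b' m x = x ↔ m (Equiv.swap b b' x) = Equiv.swap b b' x := by
  unfold exchange
  rw [Equiv.swap_apply_eq_iff]

theorem typ_exchange (hb : I.typ b = I.typ b') (m : A → A) (x : A) :
    I.typ (exchange b b' m x) = I.typ (m (Equiv.swap b b' x)) :=
  typ_swap hb _

theorem IsPairing.exchange (hb : I.typ b = I.typ b') {m : A → A} (h : I.IsPairing m) :
    I.IsPairing (exchange b b' m) := by
  refine ⟨fun a => ?_, fun a ha => ?_⟩
  · simp [RefinedTypedInstance.exchange, h.invol]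
  · rw [Ne, exchange_eq_self_iff] at ha
    have := h.acc _ ha
    rw [typ_swap hb] at this
    exact (I.acc_iff_of_typ_eq (typ_exchange hb m a)).2 this

/-- The exchange is conjugation by a transposition that preserves types, and preference by type
depends on types and on being a fixed point only. -/
theorem prefersByType_exchange (hb : I.typ b = I.typ b') {m : A → A} {x y : A} :
    I.PrefersByType (exchange b b' m) x y ↔
      I.PrefersByType m (Equiv.swap b b' x) (Equiv.swap b b' y) := by
  unfold PrefersByType
  rw [Ne, exchange_eq_self_iff, typ_exchange hb, typ_swap hb, typ_swap hb,
    I.acc_iff_of_typ_eq (typ_swap hb y)]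

theorem StableByType.exchange (hb : I.typ b = I.typ b') {m : A → A} (h : I.StableByType m) :
    I.StableByType (exchange b b' m) := by
  refine ⟨h.toIsPairing.exchange hb, fun x y hxy => ?_⟩
  rw [prefersByType_exchange hb, prefersByType_exchange hb]
  exact h.not_blocks _ _ fun e => hxy ((Equiv.swap b b').injective e)

theorem ncard_fixed_exchange (m : A → A) :
    {x | exchange b b' m x = x}.ncard = {x | m x = x}.ncard := by
  have : {x | exchange b b' m x = x} = Equiv.swap b b' ⁻¹' {x | m x = x} := by
    ext x
    exact exchange_eq_self_iff x
  rw [this]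
  exact Set.ncard_preimage_of_injective_subset_range (Equiv.injective _) (by simp)

end Swap

/-! ### The potential argument -/

section Potential

variable [Fintype A] (I : RefinedTypedInstance A T) (ρ : T → A → ℕ)

open Classical in
/-- The number of agents whose type is worse for type `j` than type `l`. -/
noncomputable def numWorse (j l : T) : ℕ :=
  (Finset.univ.filter fun x => I.PrefersType j l (I.typ x)).card

variable {I} in
theorem numWorse_lt {j : T} {a c : A} (h : I.PrefersType j (I.typ a) (I.typ c)) :
    I.numWorse j (I.typ c) < I.numWorse j (I.typ a) := by
  classical
  refine Finset.card_lt_card ⟨fun x hx => ?_, fun hs => ?_⟩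
  · rw [Finset.mem_filter] at hx ⊢
    exact ⟨hx.1, fun y z hy hz => (I.pref j).strict_trans (h y c hy rfl) (hx.2 c z rfl hz)⟩
  · have := hs (Finset.mem_filter.2 ⟨Finset.mem_univ c, h⟩)
    exact (I.pref j).not_strict_self c ((Finset.mem_filter.1 this).2 c c rfl rfl)

/-- The weight of agent `b` with a partner of the type of `q`, where `K` bounds all ranks. -/
noncomputable def typeWeight (K : ℕ) (b q : A) : ℕ :=
  K ^ I.numWorse (I.typ b) (I.typ q) * ρ (I.typ q) b

/-- The potential that measures which agents of a type are matched to which types. -/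
noncomputable def typePotential [DecidableEq A] (K : ℕ) (m : A → A) : ℕ :=
  ∑ b, if m b = b then 0 else I.typeWeight ρ K b (m b)

/-- The weight of the pair `a`, `b`. -/
def pairWeight (a b : A) : ℤ := ρ (I.typ a) b * ρ (I.typ b) a

/-- The potential that measures how assortative a matching is between the types. -/
noncomputable def pairPotential (m : A → A) : ℤ := ∑ a, I.pairWeight ρ a (m a)

theorem _root_.Finset.sum_eq_add_add_sum_filter {M : Type*} [AddCommMonoid M] (f : A → M)
    {b c : A} (h : b ≠ c) [DecidableEq A] :
    ∑ x, f x = f b + f c + ∑ x ∈ Finset.univ.filter fun x => x ≠ b ∧ x ≠ c, f x := by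
  rw [← Finset.sum_pair h, ← Finset.sum_filter_add_sum_filter_not _ fun x => x = b ∨ x = c]
  congr 1
  · exact Finset.sum_congr (by ext; simp) fun _ _ => rfl
  · exact Finset.sum_congr (by ext; simp) fun _ _ => rfl

variable {I ρ}

/-- Here `a` prefers `b` to a partner of the same type as `b`. After the exchange `a` gets `b`, and
the former partner of `a` takes over the situation of `b`. In `typePotential` the weight of a pair
grows by a factor of at least `K` when the type of the partner improves, so the gain at `a`
outweighs what the displaced agent adds. If the old partner of `b` has the type of `a`, this
potential is unchanged and `pairPotential` decides. -/
theorem potential_exchange_lt [DecidableEq A] (hst : I.StrictOverTypes)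
    (href : ∀ i x y, (I.pref i).strict x y → ρ i x < ρ i y) {K : ℕ}
    (hK : ∀ i ∈ Set.range I.typ, ∀ x, ρ i x < K)
    {m : A → A} (hm : I.IsPairing m) {a b : A} (hab : a ≠ b) (ha : m a ≠ a)
    (htyp : I.typ b = I.typ (m a)) (h1 : ρ (I.typ a) b < ρ (I.typ a) (m a))
    (hb : I.PrefersByRank ρ m b a) :
    toLex (I.typePotential ρ K (exchange b (m a) m), - I.pairPotential ρ (exchange b (m a) m)) <
      toLex (I.typePotential ρ K m, - I.pairPotential ρ m) := by
  have hbb' : b ≠ m a := by rintro rfl; exact lt_irrefl _ h1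
  have hmb : m b ≠ a := by rintro h; apply hbb'; rw [← h, hm.invol]
  have hmb' : m b ≠ m a := by
    intro h; apply hab; rw [← hm.invol a, ← h, hm.invol]
  set b' := m a with hb'
  have hmb'a : m b' = a := hm.invol a
  have ea : exchange b b' m b = a := by
    unfold exchange
    rw [Equiv.swap_apply_left, hmb'a, Equiv.swap_apply_of_ne_of_ne hab ha.symm]
  have hK0 : 0 < K := (Nat.zero_le _).trans_lt (hK _ ⟨a, rfl⟩ a)
  have rest : ∀ x, x ≠ b ∧ x ≠ b' →
      (if exchange b b' m x = x then 0 else I.typeWeight ρ K x (exchange b b' m x)) =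
        (if m x = x then 0 else I.typeWeight ρ K x (m x)) := by
    rintro x ⟨hx, hx'⟩
    have e1 := exchange_eq_self_iff (b := b) (b' := b') (m := m) x
    have e2 := typ_exchange htyp m x
    rw [Equiv.swap_apply_of_ne_of_ne hx hx'] at e1 e2
    unfold typeWeight
    rw [e2]
    by_cases h : m x = x
    · rw [if_pos h, if_pos (e1.2 h)]
    · rw [if_neg h, if_neg (mt e1.1 h)]
  have s1 : I.typePotential ρ K m = _ + _ + _ := Finset.sum_eq_add_add_sum_filter _ hbb'
  have s2 : I.typePotential ρ K (exchange b b' m) = _ + _ + _ :=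
    Finset.sum_eq_add_add_sum_filter _ hbb'
  rw [Finset.sum_congr rfl fun x hx => rest x (Finset.mem_filter.1 hx).2] at s2
  rw [ea, if_neg hab] at s2
  rw [hmb'a, if_neg (c := a = b') ha.symm] at s1
  -- Improving the rank by one is worth a full power of `K`.
  have lt_of : ∀ {p q r : ℕ}, K ^ r * p + K ^ r ≤ K ^ r * q ↔ p < q := by
    intro p q r
    rw [← Nat.mul_succ, Nat.mul_le_mul_left_iff (pow_pos hK0 _), Nat.succ_le_iff]
  have hlt : I.typeWeight ρ K b a + K ^ I.numWorse (I.typ b) (I.typ a) ≤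
      I.typeWeight ρ K b' a := by
    unfold typeWeight
    rw [htyp]
    exact lt_of.2 h1
  have hpos : 0 < K ^ I.numWorse (I.typ b) (I.typ a) := pow_pos hK0 _
  -- If `b` is unmatched, the former partner of `a` becomes unmatched and only the weight of the
  -- agent matched to `a` changes.
  by_cases hbu : m b = b
  · have eb : exchange b b' m b' = b' := by
      rw [exchange_eq_self_iff, Equiv.swap_apply_right, hbu]
    rw [eb, if_pos rfl] at s2
    rw [hbu, if_pos rfl] at s1
    exact Prod.Lex.toLex_lt_toLex.2 (Or.inl (by dsimp only; omega))
  have h2 := hb.2 hbu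
  have eb : exchange b b' m b' = m b := by
    unfold exchange
    rw [Equiv.swap_apply_right, Equiv.swap_apply_of_ne_of_ne hbu hmb']
  rw [eb, if_neg hmb'] at s2
  rw [if_neg hbu] at s1
  by_cases hac : I.typ a = I.typ (m b)
  -- The partners `a` and `m b` have one type, so the four weights are only permuted. The pair
  -- weights increase by the rearrangement inequality: `a` and `b` each rank the other before its
  -- old partner.
  · refine Prod.Lex.toLex_lt_toLex.2 (Or.inr ⟨?_, ?_⟩)
    · have e1 : I.typeWeight ρ K b (m b) = I.typeWeight ρ K b a := by
        unfold typeWeight; rw [hac]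
      have e2 : I.typeWeight ρ K b' (m b) = I.typeWeight ρ K b' a := by
        unfold typeWeight; rw [hac]
      dsimp only
      omega
    · dsimp only
      rw [neg_lt_neg_iff]
      have hac' : a ≠ m b := hmb.symm
      have ec : exchange b b' m a = b := by
        unfold exchange
        rw [Equiv.swap_apply_of_ne_of_ne hab ha.symm, ← hb', Equiv.swap_apply_right]
      have ed : exchange b b' m (m b) = b' := by
        unfold exchange
        rw [Equiv.swap_apply_of_ne_of_ne hbu hmb', hm.invol, Equiv.swap_apply_left]
      have split : ∀ f : A → ℤ, ∑ x, f x = f b + f b' + (f a + f (m b)) +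
          ∑ x ∈ Finset.univ.filter (fun x => x ≠ b ∧ x ≠ b' ∧ x ≠ a ∧ x ≠ m b), f x := by
        intro f
        rw [← Finset.sum_pair hbb', ← Finset.sum_pair hac', ← Finset.sum_union,
          ← Finset.sum_filter_add_sum_filter_not _
            fun x => x ∈ ({b, b'} : Finset A) ∪ {a, m b}]
        · congr 1
          · exact Finset.sum_congr (by ext; simp) fun _ _ => rfl
          · refine Finset.sum_congr ?_ fun _ _ => rfl
            ext
            simp
            tauto
        · rw [Finset.disjoint_left]
          intro x hx hx'
          simp only [Finset.mem_insert, Finset.mem_singleton] at hx hx'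
          rcases hx with rfl | rfl <;> rcases hx' with h | h
          · exact hab h.symm
          · exact hbu h.symm
          · exact ha h
          · exact hmb' h.symm
      have rest' : ∀ x, (x ≠ b ∧ x ≠ b' ∧ x ≠ a ∧ x ≠ m b) →
          I.pairWeight ρ x (exchange b b' m x) = I.pairWeight ρ x (m x) := by
        rintro x ⟨h1, h2, h3, h4⟩
        congr 1
        unfold exchange
        rw [Equiv.swap_apply_of_ne_of_ne h1 h2, Equiv.swap_apply_of_ne_of_ne]
        · rintro rfl; exact h4 (hm.invol x).symm
        · intro h; apply h3; rw [← hm.invol x, h, hmb'a]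
      have t1 : I.pairPotential ρ m = _ := split _
      have t2 : I.pairPotential ρ (exchange b b' m) = _ := split _
      rw [Finset.sum_congr rfl fun x hx => rest' x (Finset.mem_filter.1 hx).2] at t2
      rw [t1, t2, ea, eb, ec, ed, hmb'a, hm.invol, ← hb']
      simp only [pairWeight, ← htyp, ← hac]
      have h1' : (ρ (I.typ a) b : ℤ) < ρ (I.typ a) b' := by exact_mod_cast h1
      have h2' : (ρ (I.typ b) a : ℤ) < ρ (I.typ b) (m b) := by exact_mod_cast h2
      nlinarith [mul_pos (sub_pos.2 h1') (sub_pos.2 h2')]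
  -- Otherwise `b` strictly prefers the type of `a` to that of its old partner, so the new weight of
  -- the displaced agent stays below the power of `K` that was saved.
  · have hbacc : (I.pref (I.typ b)).acc (m b) := hm.acc b hbu
    have hp : I.PrefersType (I.typ b) (I.typ a) (I.typ (m b)) := by
      refine (hst (I.typ b) _ _ hac ⟨a, rfl, hb.1⟩ ⟨m b, rfl, hbacc⟩).resolve_right fun h => ?_
      exact absurd (href _ _ _ (h (m b) a rfl rfl)) (not_lt.2 h2.le)
    have hw := numWorse_lt hp
    have hle : I.typeWeight ρ K b' (m b) < K ^ I.numWorse (I.typ b) (I.typ a) := by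
      unfold typeWeight
      rw [← htyp]
      calc K ^ I.numWorse (I.typ b) (I.typ (m b)) * ρ (I.typ (m b)) b'
          < K ^ I.numWorse (I.typ b) (I.typ (m b)) * K :=
            Nat.mul_lt_mul_of_pos_left (hK _ ⟨_, rfl⟩ _) (pow_pos hK0 _)
        _ = K ^ (I.numWorse (I.typ b) (I.typ (m b)) + 1) := (pow_succ _ _).symm
        _ ≤ _ := Nat.pow_le_pow_right hK0 hw
    exact Prod.Lex.toLex_lt_toLex.2 (Or.inl (by dsimp only; omega))

/-- If preferences over types are strict, a matching that is stable with respect to the types can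
be rearranged within the types such that it becomes stable for any refinement of the ties. -/
theorem StableByType.exists_stableByRank (hst : I.StrictOverTypes)
    (href : ∀ i x y, (I.pref i).strict x y → ρ i x < ρ i y) {m : A → A} (hm : I.StableByType m) :
    ∃ m', I.StableByRank ρ m' ∧ {x | m' x = x}.ncard = {x | m x = x}.ncard := by
  classical
  -- There may be infinitely many types; only those of agents have to be bounded.
  obtain ⟨K, hK⟩ : ∃ K, ∀ i ∈ Set.range I.typ, ∀ x, ρ i x < K := by
    refine ⟨∑ a, ∑ x, ρ (I.typ a) x + 1, ?_⟩
    rintro _ ⟨a, rfl⟩ x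
    refine Nat.lt_succ_of_le ?_
    refine le_trans ?_ (Finset.single_le_sum (f := fun a => ∑ x, ρ (I.typ a) x)
      (fun _ _ => Nat.zero_le _) (Finset.mem_univ a))
    exact Finset.single_le_sum (f := fun x => ρ (I.typ a) x) (fun _ _ => Nat.zero_le _)
      (Finset.mem_univ x)
  let S : Set (A → A) := {m' | I.StableByType m' ∧ {x | m' x = x}.ncard = {x | m x = x}.ncard}
  obtain ⟨m', hm', hmin⟩ := Set.exists_min_image S
    (fun m' => toLex (I.typePotential ρ K m', - I.pairPotential ρ m')) (Set.toFinite S)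
    ⟨m, hm, rfl⟩
  -- At a minimiser no preference in a blocking pair can come from inside a type, since the exchange
  -- would lower the potential. By strictness over types it comes from the types, so a pair blocking
  -- by rank blocks by type.
  have key : ∀ a b, a ≠ b → I.PrefersByRank ρ m' a b → I.PrefersByRank ρ m' b a →
      I.PrefersByType m' a b := by
    intro a b hab h1 h2
    refine ⟨h1.1, fun ha => ?_⟩
    by_contra hnot
    by_cases htyp : I.typ b = I.typ (m' a)
    · refine absurd (hmin _ ⟨hm'.1.exchange htyp, ?_⟩) (not_le.2
        (potential_exchange_lt hst href hK hm'.1.toIsPairing hab ha htyp (h1.2 ha) h2))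
      rw [ncard_fixed_exchange, hm'.2]
    · refine hnot ((hst _ _ _ htyp ⟨b, rfl, h1.1⟩ ⟨m' a, rfl, hm'.1.acc a ha⟩).resolve_right
        fun h => ?_)
      exact absurd (href _ _ _ (h (m' a) b rfl rfl)) (not_lt.2 (h1.2 ha).le)
  exact ⟨m', ⟨hm'.1.toIsPairing, fun a b hab h =>
    hm'.1.not_blocks a b hab ⟨key a b hab h.1 h.2, key b a hab.symm h.2 h.1⟩⟩, hm'.2⟩

end Potential

end RefinedTypedInstance

/-! ### Stable matchings and stable involutions -/

/-- The number of pairs of a matching is half the number of matched agents. -/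
theorem two_mul_matchingSize {A : Type*} [Finite A] {M : A → Option A}
    (symm : ∀ a b, M a = some b → M b = some a) (irrefl : ∀ a, M a ≠ some a) :
    2 * matchingSize M = {a | M a ≠ none}.ncard := by
  classical
  have := Fintype.ofFinite A
  -- The handshake lemma for the graph of matched pairs, whose degrees are zero or one.
  let G : SimpleGraph A := ⟨fun a b => M a = some b, ⟨symm⟩, ⟨irrefl⟩⟩
  have h1 := G.sum_degrees_eq_twice_card_edges
  have h2 : matchingSize M = G.edgeFinset.card := by
    rw [← Set.ncard_coe_finset, SimpleGraph.coe_edgeFinset]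
    unfold matchingSize
    congr 1
    ext e
    induction e with | _ a b => ?_
    simp only [Set.mem_ofPred_eq, SimpleGraph.mem_edgeSet, G]
    constructor
    · rintro ⟨c, d, h, e⟩
      rcases Sym2.eq_iff.1 e with ⟨rfl, rfl⟩ | ⟨rfl, rfl⟩
      · exact h
      · exact symm _ _ h
    · exact fun h => ⟨a, b, h, rfl⟩
  rw [h2, ← h1]
  have h3 : ∀ a, G.degree a = if M a ≠ none then 1 else 0 := by
    intro a
    rw [← SimpleGraph.card_neighborFinset_eq_degree]
    rcases hM : M a with _ | b
    · rw [if_neg (by simp), Finset.card_eq_zero, Finset.eq_empty_iff_forall_notMem]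
      intro b
      simp [G, hM]
    · rw [if_pos (by simp), Finset.card_eq_one]
      refine ⟨b, ?_⟩
      ext c
      simp [G, hM, eq_comm]
  rw [Finset.sum_congr rfl fun a _ => h3 a, Finset.sum_boole, Set.ncard_eq_toFinset_card']
  simp

/-- The partner function of an involution whose fixed points are the unmatched agents. -/
def partnerOf {A : Type*} [DecidableEq A] (m : A → A) (a : A) : Option A :=
  if m a = a then none else some (m a)

theorem partnerOf_eq_some_iff {A : Type*} [DecidableEq A] {m : A → A} {a b : A} :
    partnerOf m a = some b ↔ m a = b ∧ m a ≠ a := by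
  unfold partnerOf
  split_ifs with h <;> simp [h]

/-! ### Passing between matchings with ties and strict ranks -/

namespace RefinedTypedInstance

variable {A T : Type*} {I : RefinedTypedInstance A T}

/-- The ranks `R` break the ties of `I` such that type `i` orders the agents by `ρ i`. -/
structure BreaksTies (I : RefinedTypedInstance A T) (ρ : T → A → ℕ) (R : A → A → ℕ) : Prop where
  inj : ∀ a, Function.Injective (R a)
  acc_iff : ∀ a b, b ≠ a → ((I.pref (I.typ a)).acc b ↔ R a b < R a a)
  lt_iff : ∀ a b c, b ≠ a → c ≠ a → (I.pref (I.typ a)).acc b → (I.pref (I.typ a)).acc c →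
    (R a b < R a c ↔ ρ (I.typ a) b < ρ (I.typ a) c)
  refines : ∀ i x y, (I.pref i).strict x y → ρ i x < ρ i y

open StrictRoommates

theorem BreaksTies.acc_of_stable {ρ : T → A → ℕ} {R : A → A → ℕ} (hR : I.BreaksTies ρ R)
    {m : A → A} (h : Stable R m) {a : A} (ha : m a ≠ a) : (I.pref (I.typ a)).acc (m a) := by
  rw [hR.acc_iff a _ ha]
  have := h.not_blocks a a
  exact lt_of_le_of_ne (by omega) fun e => ha (hR.inj a e)

/-- Strict preference in the list implies a smaller rank, so refining ties can only create blocking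
pairs. -/
theorem BreaksTies.isStable_partnerOf [DecidableEq A] {ρ : T → A → ℕ} {R : A → A → ℕ}
    (hR : I.BreaksTies ρ R) {m : A → A} (h : Stable R m) :
    I.toSRTI.IsStable (partnerOf m) := by
  refine ⟨⟨fun a b hab => ?_, fun a b hab => ?_⟩, fun a b hab => ?_⟩
  · rw [partnerOf_eq_some_iff] at hab ⊢
    obtain ⟨rfl, hne⟩ := hab
    rw [h.invol]
    exact ⟨rfl, hne.symm⟩
  · rw [partnerOf_eq_some_iff] at hab
    obtain ⟨rfl, hne⟩ := hab
    exact ⟨hne, hR.acc_of_stable h hne⟩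
  · obtain ⟨_, h1, h2⟩ := hab
    have key : ∀ a b, I.toSRTI.PrefersToPartner (partnerOf m) a b → R a b < R a (m a) := by
      rintro a b ⟨⟨hne, hacc⟩, hc⟩
      by_cases ha : m a = a
      · rwa [ha, ← hR.acc_iff a b hne]
      · rw [hR.lt_iff a b _ hne ha hacc (hR.acc_of_stable h ha)]
        obtain ⟨h1, h2, h3⟩ := hc _ (partnerOf_eq_some_iff.2 ⟨rfl, ha⟩)
        exact hR.refines _ _ _ ⟨h1.2, h2.2, h3⟩
    exact h.not_blocks a b ⟨key a b h1, key b a h2⟩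

/-- Preference by type implies strict preference, so fewer pairs can block. The case of two partners
of each other is excluded because no agent is strictly preferred to itself. -/
theorem stableByType_of_isStable {M : A → Option A} (hM : I.toSRTI.IsStable M) :
    I.StableByType fun a => (M a).getD a := by
  have some_of_ne : ∀ {a}, (M a).getD a ≠ a → M a = some ((M a).getD a) := by
    intro a ha
    rcases h : M a with _ | b
    · simp [h] at ha
    · rfl
  refine ⟨⟨fun a => ?_, fun a ha => (hM.1.acc _ _ (some_of_ne ha)).2⟩, fun a b hab h => ?_⟩
  · rcases h : M a with _ | b
    · simp [h]
    · simp [hM.1.symm _ _ h]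
  · have key : ∀ a b, a ≠ b → I.PrefersByType (fun a => (M a).getD a) a b →
        I.toSRTI.PrefersToPartner M a b := by
      rintro a b hab ⟨hacc, hp⟩
      refine ⟨⟨hab.symm, hacc⟩, fun c hc => ?_⟩
      have hca : c ≠ a := (hM.1.acc a c hc).1
      have h1 := hp (by simpa [hc] using hca)
      obtain ⟨h2, h3, h4⟩ := h1 b c rfl (by simp [hc])
      exact ⟨⟨hab.symm, h2⟩, ⟨hca, h3⟩, h4⟩
    refine hM.2 a b ⟨fun e => ?_, key a b hab h.1, key b a hab.symm h.2⟩
    have h1 := h.1.2 (by simpa [e] using hab.symm)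
    exact (I.pref _).not_strict_self b (h1 b b rfl (by simp [e]))

/-- Combines the passage to stability by type with the potential argument. The count of unmatched
agents is carried along for the comparison of sizes. -/
theorem BreaksTies.exists_stable [Finite A] (hst : I.StrictOverTypes) {ρ : T → A → ℕ}
    {R : A → A → ℕ} (hR : I.BreaksTies ρ R) {M : A → Option A} (hM : I.toSRTI.IsStable M) :
    ∃ m, Stable R m ∧ {a | m a = a}.ncard = {a | M a = none}.ncard := by
  have := Fintype.ofFinite A
  obtain ⟨m, hm, hcard⟩ := (stableByType_of_isStable hM).exists_stableByRank hst hR.refines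
  refine ⟨m, ⟨hm.invol, ?_⟩, ?_⟩
  · rintro x y ⟨h1, h2⟩
    have hle : ∀ x, R x (m x) ≤ R x x := by
      intro x
      by_cases hx : m x = x
      · rw [hx]
      · exact ((hR.acc_iff x _ hx).1 (hm.acc x hx)).le
    by_cases hxy : x = y
    · subst hxy
      exact absurd h1 (not_lt.2 (hle x))
    have key : ∀ x y, x ≠ y → R x y < R x (m x) → I.PrefersByRank ρ m x y := by
      intro x y hxy h
      have hacc := (hR.acc_iff x y hxy.symm).2 (h.trans_le (hle x))
      exact ⟨hacc, fun hx => (hR.lt_iff x y _ hxy.symm hx hacc (hm.acc x hx)).1 h⟩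
    exact hm.not_blocks x y hxy ⟨key x y hxy h1, key y x (Ne.symm hxy) h2⟩
  · rw [hcard]
    congr 1
    ext a
    rcases h : M a with _ | b
    · simp [h]
    · simpa [h] using (hM.1.acc a b h).1

/-! ### Breaking ties by an index -/

/-- The candidates are ordered by `rk`, agent `a` itself is inserted after all acceptable
candidates, and ties are broken by `idx`; here `rk` is `0` for unacceptable candidates. -/
def tieBreak [DecidableEq A] (typ : A → T) (rk : T → A → ℕ) (idx : A → ℕ) (B N : ℕ) (a b : A) : ℕ :=
  (if b = a then B else if rk (typ a) b = 0 then B + 1 else rk (typ a) b) * N + idx b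

theorem _root_.Nat.mul_add_inj {N a b c d : ℕ} (hb : b < N) (hd : d < N)
    (h : a * N + b = c * N + d) : a = c ∧ b = d := by
  have h1 := congrArg (· / N) h
  have h2 := congrArg (· % N) h
  have hN : 0 < N := by omega
  simp only [Nat.mul_comm a, Nat.mul_comm c, Nat.mul_add_div hN, Nat.mul_add_mod,
    Nat.div_eq_of_lt hb, Nat.div_eq_of_lt hd, Nat.mod_eq_of_lt hb, Nat.mod_eq_of_lt hd] at h1 h2
  exact ⟨by simpa using h1, h2⟩

theorem _root_.Nat.mul_add_lt_of_lt {N a b c d : ℕ} (hb : b < N) (h : a < c) :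
    a * N + b < c * N + d := by
  nlinarith [Nat.mul_le_mul_right N (Nat.succ_le_of_lt h)]

/-- Since `idx` stays below `N`, comparing `tieBreak` is comparing lexicographically. Only the order
induced by `R` is assumed, so the lemma covers both `tieBreak` itself and the ranks that the program
obtains by counting. -/
theorem breaksTies_of_tieBreak [DecidableEq A] {rk : T → A → ℕ} {idx : A → ℕ} {B N : ℕ}
    (hacc : ∀ i x, rk i x = 0 ↔ ¬ (I.pref i).acc x)
    (hlt : ∀ i x y, (I.pref i).strict x y → rk i x < rk i y)
    (hB : ∀ i x, rk i x < B) (hN : ∀ x, idx x < N) (hidx : Function.Injective idx)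
    {R : A → A → ℕ}
    (hR : ∀ a b c, R a b < R a c ↔ tieBreak I.typ rk idx B N a b < tieBreak I.typ rk idx B N a c) :
    I.BreaksTies (fun i x => rk i x * N + idx x) R := by
  refine ⟨fun a b c hbc => ?_, fun a b hb => ?_, fun a b c hb hc hab hac => ?_, fun i x y h => ?_⟩
  · have h1 := hR a b c
    have h2 := hR a c b
    rw [hbc] at h1 h2
    have h3 : tieBreak I.typ rk idx B N a b = tieBreak I.typ rk idx B N a c := by
      have := lt_irrefl (R a c)
      omega
    exact hidx (Nat.mul_add_inj (hN _) (hN _) h3).2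
  · rw [hR]
    unfold tieBreak
    rw [if_neg hb, if_pos rfl]
    constructor
    · intro h
      rw [if_neg (fun h0 => (hacc _ _).1 h0 h)]
      exact Nat.mul_add_lt_of_lt (hN _) (hB _ _)
    · intro h
      by_contra h0
      rw [if_pos ((hacc _ _).2 h0)] at h
      exact absurd h (Nat.mul_add_lt_of_lt (hN _) (Nat.lt_succ_self B)).not_gt
  · rw [hR]
    unfold tieBreak
    rw [if_neg hb, if_neg hc, if_neg (fun h0 => (hacc _ _).1 h0 hab),
      if_neg (fun h0 => (hacc _ _).1 h0 hac)]
  · exact Nat.mul_add_lt_of_lt (hN _) (hlt i x y h)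

end RefinedTypedInstance

namespace Pref

variable {C : Type*} (P : Pref C)

theorem rank_eq_zero_iff {b : C} : P.rank b = 0 ↔ ¬ P.acc b := by
  unfold rank
  split_ifs with h <;> simp [h]

theorem rank_lt_rank [Finite C] {b c : C} (h : P.strict b c) : P.rank b < P.rank c := by
  unfold rank
  rw [if_pos h.1, if_pos h.2.1]
  refine Nat.add_lt_add_left (Set.ncard_lt_ncard ⟨fun d hd => ?_, fun hs => ?_⟩ (Set.toFinite _)) _
  · exact P.strict_trans hd h
  · exact P.not_strict_self b (hs h)

theorem rank_le_card [Finite C] (b : C) : P.rank b ≤ Nat.card C + 1 := by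
  unfold rank
  split_ifs with h
  · rw [Nat.add_comm]
    exact Nat.add_le_add_right (Set.ncard_le_card _) 1
  · exact Nat.zero_le _

end Pref

/-! ### Equality of the sizes of stable matchings -/

namespace RefinedTypedInstance

variable {A T : Type*} {I : RefinedTypedInstance A T}

theorem exists_breaksTies [Finite A] (I : RefinedTypedInstance A T) :
    ∃ ρ R, I.BreaksTies ρ R := by
  classical
  obtain ⟨n, ⟨e⟩⟩ := Finite.exists_equiv_fin A
  exact ⟨_, _, breaksTies_of_tieBreak (rk := fun i => (I.pref i).rank)
    (idx := fun x => (e x : ℕ)) (B := Nat.card A + 2) (N := n)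
    (fun i x => (I.pref i).rank_eq_zero_iff) (fun i x y => (I.pref i).rank_lt_rank)
    (fun i x => Nat.lt_succ_of_le ((I.pref i).rank_le_card x)) (fun x => (e x).2)
    (fun x y h => e.injective (Fin.ext h)) (fun _ _ _ => Iff.rfl)⟩

/-- All stable matchings have the same size. -/
theorem matchingSize_eq_of_isStable [Finite A] (hst : I.StrictOverTypes) {M M' : A → Option A}
    (hM : I.toSRTI.IsStable M) (hM' : I.toSRTI.IsStable M') :
    matchingSize M = matchingSize M' := by
  obtain ⟨ρ, R, hR⟩ := I.exists_breaksTies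
  obtain ⟨m, hm, hc⟩ := hR.exists_stable hst hM
  obtain ⟨m', hm', hc'⟩ := hR.exists_stable hst hM'
  have h1 : {a | m a = a} = {a | m' a = a} := by
    ext a
    exact ⟨hm'.fixed_of_fixed hR.inj hm, hm.fixed_of_fixed hR.inj hm'⟩
  -- Unmatched agents and twice the number of pairs add up to all agents, so equal fixed point sets
  -- give equal sizes.
  have key : ∀ {M}, I.toSRTI.IsStable M →
      {a | M a = none}.ncard + 2 * matchingSize M = Nat.card A := by
    intro M hM
    rw [two_mul_matchingSize hM.1.symm fun a ha => (hM.1.acc a a ha).1 rfl]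
    exact Set.ncard_add_ncard_compl {a | M a = none}
  have h2 := key hM
  have h3 := key hM'
  rw [← hc, h1, hc'] at h2
  omega

theorem BreaksTies.isMaxStable_partnerOf [Finite A] [DecidableEq A] (hst : I.StrictOverTypes)
    {ρ : T → A → ℕ} {R : A → A → ℕ} (hR : I.BreaksTies ρ R) {m : A → A}
    (h : StrictRoommates.Stable R m) : I.toSRTI.IsMaxStable (partnerOf m) :=
  ⟨hR.isStable_partnerOf h, fun _ hM' =>
    (matchingSize_eq_of_isStable hst hM' (hR.isStable_partnerOf h)).le⟩

end RefinedTypedInstance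

theorem TypedInstance.StrictOverTypes.toRefined {A T : Type*} {I : TypedInstance A T}
    (h : I.StrictOverTypes) : I.toRefined.StrictOverTypes := by
  rintro i j l hjl ⟨x, rfl, hx⟩ ⟨y, rfl, hy⟩
  refine (h i _ _ hjl hx hy).imp (fun h1 a b ha hb => ?_) fun h1 a b ha hb => ?_ <;>
  · change (I.pref i).strict (I.typ a) (I.typ b)
    change I.typ a = _ at ha
    change I.typ b = _ at hb
    rw [ha, hb]
    exact h1

/-! ### Programs with bounded loops -/

namespace RAM

/-- Programs whose loops run over `0, …, N - 1`, where `N` is the length of the input word. -/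
inductive Cmd : Type
  | skip
  | assign (b : ℕ) (e f : Term)
  | seq (p q : Cmd)
  | ite (e : Term) (p q : Cmd)
  | loop (v : ℕ) (p : Cmd)

namespace Cmd

/-- The effect of a command. -/
def den : Cmd → Store → Store
  | skip, s => s
  | assign b e f, s => s.write b (e.eval s) (f.eval s)
  | seq p q, s => q.den (p.den s)
  | ite e p q, s => if e.eval s ≠ 0 then p.den s else q.den s
  | .loop v p, s => (fun s' => (p.den s').write v 0 (p.den s' v 0 + 1))^[s 0 0] (s.write v 0 0)

/-- The banks a command may write to. -/
def writes : Cmd → List ℕ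
  | skip => []
  | assign b _ _ => [b]
  | seq p q => p.writes ++ q.writes
  | ite _ p q => p.writes ++ q.writes
  | .loop v p => v :: p.writes

/-- The loops do not change their counters, and the input is not changed. -/
def WF : Cmd → Prop
  | skip => True
  | assign b _ _ => b ≠ 0
  | seq p q => p.WF ∧ q.WF
  | ite _ p q => p.WF ∧ q.WF
  | .loop v p => v ≠ 0 ∧ v ∉ p.writes ∧ p.WF

/-- The content of the first cell of a bank. -/
abbrev _root_.RAM.Term.var (b : ℕ) : Term := .cell b (.const 0)

/-- Translation into programs with unbounded loops. -/
def compile : Cmd → Program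
  | skip => .skip
  | assign b e f => .assign b e f
  | seq p q => .seq p.compile q.compile
  | ite e p q => .ite e p.compile q.compile
  | .loop v p => .seq (.assign v (.const 0) (.const 0))
      (.loop (.sub (.var 0) (.var v))
        (.seq p.compile (.assign v (.const 0) (.add (.var v) (.const 1)))))

open Polynomial in
/-- A bound for the running time, as a polynomial in the length of the input word. -/
noncomputable def bound : Cmd → Polynomial ℕ
  | skip => 1
  | assign _ e f => C (e.cost + f.cost + 1)
  | seq p q => p.bound + q.bound
  | ite e p q => C (e.cost + 1) + p.bound + q.bound
  | .loop _ p => C 9 + X * (p.bound + C 12)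

theorem _root_.RAM.Store.write_of_ne (s : Store) {b b' : ℕ} (h : b' ≠ b) (i x : ℕ) :
    s.write b i x b' = s b' := Function.update_of_ne h _ _

theorem _root_.RAM.Store.write_self (s : Store) (b i x : ℕ) :
    s.write b i x b = Function.update (s b) i x := Function.update_self _ _ _

/-- The frame rule on which all later correctness proofs rely. -/
theorem den_of_notMem_writes (c : Cmd) (s : Store) {b : ℕ} (hb : b ∉ c.writes) :
    c.den s b = s b := by
  induction c generalizing s with
  | skip => rfl
  | assign b' e f => exact s.write_of_ne (by simpa [writes] using hb) _ _
  | seq p q hp hq =>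
    simp only [writes, List.mem_append, not_or] at hb
    rw [den, hq _ hb.2, hp _ hb.1]
  | ite e p q hp hq =>
    simp only [writes, List.mem_append, not_or] at hb
    rw [den]
    split_ifs
    · exact hp _ hb.1
    · exact hq _ hb.2
  | loop v p hp =>
    simp only [writes, List.mem_cons, not_or] at hb
    rw [den]
    have : ∀ n s', s' b = s b →
        ((fun s' => (p.den s').write v 0 (p.den s' v 0 + 1))^[n] s') b = s b := by
      intro n
      induction n with
      | zero => exact fun s' h => h
      | succ n ih =>
        intro s' h
        rw [Function.iterate_succ_apply]
        refine ih _ ?_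
        rw [Store.write_of_ne _ hb.1, hp _ hb.2, h]
    exact this _ _ (s.write_of_ne hb.1 _ _)

theorem WF.zero_notMem_writes {c : Cmd} (h : c.WF) : 0 ∉ c.writes := by
  induction c with
  | skip => simp [writes]
  | assign b e f => simpa [writes] using Ne.symm h
  | seq p q hp hq => simpa [writes] using ⟨hp h.1, hq h.2⟩
  | ite e p q hp hq => simpa [writes] using ⟨hp h.1, hq h.2⟩
  | loop v p hp => simpa [writes] using ⟨Ne.symm h.1, hp h.2.2⟩

/-- The body of a loop can change neither its counter nor the length in bank `0`. So the translated
loop makes exactly that many rounds, and the bound of the body is evaluated at the same number each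
time. -/
theorem WF.exec {c : Cmd} (h : c.WF) (s : Store) :
    ∃ t ≤ c.bound.eval (s 0 0), Exec c.compile s (c.den s) t := by
  induction c generalizing s with
  | skip => exact ⟨1, by simp [bound], .skip s⟩
  | assign b e f => exact ⟨_, by simp [bound], .assign b e f s⟩
  | seq p q hp hq =>
    obtain ⟨t, ht, e⟩ := hp h.1 s
    obtain ⟨t', ht', e'⟩ := hq h.2 (p.den s)
    rw [den_of_notMem_writes p s h.1.zero_notMem_writes] at ht'
    exact ⟨t + t', by simp only [bound, Polynomial.eval_add]; omega, .seq e e'⟩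
  | ite e p q hp hq =>
    by_cases he : e.eval s = 0
    · obtain ⟨t, ht, e'⟩ := hq h.2 s
      refine ⟨e.cost + 1 + t, ?_, ?_⟩
      · simp only [bound, Polynomial.eval_add, Polynomial.eval_C]; omega
      · rw [den, if_neg (by simpa using he)]
        exact .ite_false he e'
    · obtain ⟨t, ht, e'⟩ := hp h.1 s
      refine ⟨e.cost + 1 + t, ?_, ?_⟩
      · simp only [bound, Polynomial.eval_add, Polynomial.eval_C]; omega
      · rw [den, if_pos he]
        exact .ite_true he e'
  | loop v p hp =>
    obtain ⟨hv, hvp, hpw⟩ := h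
    set step : Store → Store := fun s' => (p.den s').write v 0 (p.den s' v 0 + 1) with hstep
    -- In each round the test and the increment of the counter cost 6 each; the final 6 is the
    -- failing test.
    have key : ∀ k s', s' 0 0 = s 0 0 → s' v 0 + k = s 0 0 →
        ∃ t ≤ k * (p.bound.eval (s 0 0) + 12) + 6,
          Exec (.loop (.sub (.var 0) (.var v))
            (.seq p.compile (.assign v (.const 0) (.add (.var v) (.const 1)))))
            s' (step^[k] s') t := by
      intro k
      induction k with
      | zero =>
        intro s' h0 hk
        exact ⟨_, by simp [Term.cost], Exec.loop_stop (by simp [Term.eval]; omega)⟩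
      | succ k ih =>
        intro s' h0 hk
        obtain ⟨t, ht, e⟩ := hp hpw s'
        rw [h0] at ht
        have e1 : step s' 0 0 = s 0 0 := by
          rw [hstep, ← h0]
          dsimp only
          rw [Store.write_of_ne _ hv.symm, den_of_notMem_writes p s' hpw.zero_notMem_writes]
        have e2 : step s' v 0 + k = s 0 0 := by
          rw [hstep]
          dsimp only
          rw [Store.write_self, Function.update_self, den_of_notMem_writes p s' hvp]
          omega
        obtain ⟨t', ht', e'⟩ := ih (step s') e1 e2
        refine ⟨_, ?_, .loop_step (by simp [Term.eval]; omega)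
          (.seq e (.assign v _ _ _)) e'⟩
        simp only [Term.cost]
        rw [Nat.succ_mul]
        omega
    obtain ⟨t, ht, e⟩ := key (s 0 0) (s.write v 0 0)
      (by rw [Store.write_of_ne _ hv.symm])
      (by rw [Store.write_self, Function.update_self, Nat.zero_add])
    refine ⟨_, ?_, .seq (.assign v _ _ s) e⟩
    simp only [Term.cost, bound, Polynomial.eval_add, Polynomial.eval_C, Polynomial.eval_mul,
      Polynomial.eval_X]
    omega

/-- The rule for loops with an invariant. -/
theorem den_loop_of_invariant {v : ℕ} {p : Cmd} (h : (Cmd.loop v p).WF) (s : Store)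
    (Inv : ℕ → Store → Prop) (h0 : Inv 0 (s.write v 0 0))
    (hs : ∀ j s', j < s 0 0 → Inv j s' → s' v 0 = j →
      (∀ b, b ∉ (Cmd.loop v p).writes → s' b = s b) →
      Inv (j + 1) ((p.den s').write v 0 (j + 1))) :
    Inv (s 0 0) ((Cmd.loop v p).den s) := by
  set step : Store → Store := fun s' => (p.den s').write v 0 (p.den s' v 0 + 1) with hstep
  have key : ∀ j ≤ s 0 0, Inv j (step^[j] (s.write v 0 0)) ∧ step^[j] (s.write v 0 0) v 0 = j ∧
      ∀ b, b ∉ (Cmd.loop v p).writes → step^[j] (s.write v 0 0) b = s b := by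
    intro j
    induction j with
    | zero =>
      refine fun _ => ⟨h0, by simp [Store.write_self], fun b hb => s.write_of_ne ?_ _ _⟩
      simp only [writes, List.mem_cons, not_or] at hb
      exact hb.1
    | succ j ih =>
      intro hj
      obtain ⟨h1, h2, h3⟩ := ih (by omega)
      rw [Function.iterate_succ_apply']
      generalize step^[j] (s.write v 0 0) = s' at h1 h2 h3
      have h4 : p.den s' v 0 = j := by rw [den_of_notMem_writes p s' h.2.1, h2]
      have h5 : step s' = (p.den s').write v 0 (j + 1) := by rw [hstep, ← h4]
      refine ⟨h5 ▸ hs j s' hj h1 h2 h3, by simp [h5, Store.write_self], fun b hb => ?_⟩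
      have hb' := hb
      simp only [writes, List.mem_cons, not_or] at hb'
      rw [h5, Store.write_of_ne _ hb'.1, den_of_notMem_writes p s' hb'.2, h3 b hb]
  exact (key _ le_rfl).1

end Cmd

theorem _root_.Polynomial.eval_mono_nat (P : Polynomial ℕ) {a b : ℕ} (h : a ≤ b) :
    P.eval a ≤ P.eval b := by
  rw [Polynomial.eval_eq_sum, Polynomial.eval_eq_sum]
  exact Finset.sum_le_sum fun i _ => Nat.mul_le_mul_left _ (Nat.pow_le_pow_left h i)

theorem length_le_inputSize (w : List ℕ) : w.length ≤ inputSize w := by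
  unfold inputSize
  induction w with
  | nil => simp
  | cons a w ih => simp only [List.map_cons, List.sum_cons, List.length_cons]; omega

/-- A search problem is solvable in polynomial time if a program with bounded loops solves it. -/
theorem PolyTimeSolvable.of_cmd {X : Type*} {Dom : X → Prop} {encode : X → List ℕ}
    {Sol : X → List ℕ → Prop} (c : Cmd) (hc : c.WF)
    (h : ∀ x, Dom x → Sol x (output (c.den (initStore (encode x))))) :
    PolyTimeSolvable Dom encode Sol := by
  refine ⟨c.compile, c.bound, fun x hx => ?_⟩
  obtain ⟨t, ht, e⟩ := hc.exec (initStore (encode x))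
  refine ⟨_, t, e, ht.trans (Polynomial.eval_mono_nat _ ?_), h x hx⟩
  simpa [initStore] using length_le_inputSize (encode x)

end RAM

/-! ### Rules for reasoning about loops -/

namespace RAM

theorem Store.write_apply (s : Store) (b i x b' i' : ℕ) :
    s.write b i x b' i' = if b' = b ∧ i' = i then x else s b' i' := by
  by_cases hb : b' = b
  · subst hb
    rw [Store.write_self]
    by_cases hi : i' = i
    · subst hi; simp
    · simp [hi]
  · rw [Store.write_of_ne _ hb]; simp [hb]

namespace Cmd

theorem den_seq (p q : Cmd) (s : Store) : (seq p q).den s = q.den (p.den s) := rfl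

theorem den_ite_of_ne {e : Term} {p q : Cmd} {s : Store} (h : e.eval s ≠ 0) :
    (ite e p q).den s = p.den s := if_pos h

theorem den_ite_of_eq {e : Term} {p q : Cmd} {s : Store} (h : e.eval s = 0) :
    (ite e p q).den s = q.den s := if_neg (not_not.2 h)

/-- The rule for loops with an invariant that does not depend on the loop counter. -/
theorem den_loop_of_invariant' {v : ℕ} {p : Cmd} (h : (Cmd.loop v p).WF) (s : Store)
    (Inv : ℕ → Store → Prop) (hv : ∀ k s' x, Inv k s' → Inv k (s'.write v 0 x)) (h0 : Inv 0 s)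
    (hs : ∀ j s', j < s 0 0 → Inv j s' → s' v 0 = j →
      (∀ b, b ∉ (Cmd.loop v p).writes → s' b = s b) → Inv (j + 1) (p.den s')) :
    Inv (s 0 0) ((Cmd.loop v p).den s) :=
  den_loop_of_invariant h s Inv (hv _ _ _ h0) fun j s' hj h1 h2 h3 => hv _ _ _ (hs j s' hj h1 h2 h3)

/-- The rule for two nested loops with an invariant that does not depend on the loop counters. -/
theorem den_loop_loop_of_invariant {v w : ℕ} {p : Cmd} (h : (Cmd.loop v (.loop w p)).WF) (s : Store)
    (Inv : ℕ → Store → Prop) (hv : ∀ k s' x, Inv k s' → Inv k (s'.write v 0 x))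
    (hw : ∀ k s' x, Inv k s' → Inv k (s'.write w 0 x)) (h0 : Inv 0 s)
    (hs : ∀ x y s', x < s 0 0 → y < s 0 0 → Inv (x * s 0 0 + y) s' → s' v 0 = x → s' w 0 = y →
      (∀ b, b ∉ (Cmd.loop v (.loop w p)).writes → s' b = s b) →
      Inv (x * s 0 0 + y + 1) (p.den s')) :
    Inv (s 0 0 * s 0 0) ((Cmd.loop v (.loop w p)).den s) := by
  have h0w := h.zero_notMem_writes
  refine den_loop_of_invariant' h s (fun j s' => Inv (j * s 0 0) s')
    (fun k s' x => hv _ s' x) (by simpa using h0) fun x s' hx h1 h2 h3 => ?_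
  have h4 : s' 0 0 = s 0 0 := by rw [h3 0 h0w]
  have := den_loop_of_invariant' h.2.2 s' (fun j s' => Inv (x * s 0 0 + j) s')
    (fun k s' x => hw _ s' x) (by simpa using h1) fun y s'' hy h5 h6 h7 => ?_
  · rw [h4] at this
    rwa [Nat.succ_mul]
  · refine hs x y s'' hx (h4 ▸ hy) h5 ?_ h6 fun b hb => ?_
    · rw [h7 v h.2.1, h2]
    · rw [h7 b fun hb' => hb (List.mem_cons_of_mem _ hb'), h3 b hb]

end Cmd

/-! ### The program

The banks are used as follows: `0` input, `1` output, `2` to `9` loop counters, `10` flag,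
`11` multiples of the length `N` of the input word, `12` multiples of the row length of the table of
ranks in the input, `13` table of the ranks with unacceptable candidates last, `14` table of the
strict ranks, `15` the best known upper bounds for the ranks of the partners, `16` and `17` lower
and upper bounds during a sequence of proposals.  Tables have rows of length `N`. -/

namespace Solver

open Cmd StrictRoommates

/-- An entry of a table. -/
abbrev entry (b : ℕ) (x y : Term) : Term := .cell b (.add (.cell 11 x) y)

/-- A term that is `0` if and only if `e` and `f` are equal. -/
abbrev dist (e f : Term) : Term := .add (.sub e f) (.sub f e)

/-- The number of agents. -/
abbrev numAgents : Term := .cell 0 (.const 1)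

/-- Compute the multiples of `N` and of `width`. -/
def offsets (width : Term) : Cmd :=
  .loop 2 (.seq (.assign 11 (.add (.var 2) (.const 1)) (.add (.cell 11 (.var 2)) (.var 0)))
    (.assign 12 (.add (.var 2) (.const 1)) (.add (.cell 12 (.var 2)) width)))

/-- Compute the table of ranks, with the agent itself after the acceptable candidates. -/
def keys (rk : Term) : Cmd :=
  .loop 2 (.loop 3 (.ite (dist (.var 2) (.var 3))
    (.ite rk (.assign 13 (.add (.cell 11 (.var 2)) (.var 3)) rk)
      (.assign 13 (.add (.cell 11 (.var 2)) (.var 3)) (.add (.var 0) (.const 1))))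
    (.assign 13 (.add (.cell 11 (.var 2)) (.var 3)) (.var 0))))

/-- Count the candidates before a given one, where ties are broken by the index. -/
def countBefore : Cmd :=
  .loop 4 (.ite (.sub numAgents (.var 4))
    (.ite (.sub (.add (entry 13 (.var 2) (.var 3))
        (.sub (.const 1) (.sub (.const 1) (.sub (.var 3) (.var 4))))) (entry 13 (.var 2) (.var 4)))
      (.assign 14 (.add (.cell 11 (.var 2)) (.var 3))
        (.add (entry 14 (.var 2) (.var 3)) (.const 1)))
      .skip)
    .skip)

/-- Compute the table of strict ranks. -/
def strictRanks : Cmd :=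
  .loop 2 (.loop 3 (.seq (.assign 14 (.add (.cell 11 (.var 2)) (.var 3)) (.const 0)) countBefore))

/-- One proposal. -/
def proposal : Cmd :=
  .ite (.sub numAgents (.var 2))
    (.ite (.sub numAgents (.var 3))
      (.ite (dist (entry 14 (.var 2) (.var 3)) (.cell 16 (.var 2))) .skip
        (.ite (.sub (entry 14 (.var 3) (.var 2)) (.cell 17 (.var 3)))
          (.assign 16 (.var 2) (.add (.cell 16 (.var 2)) (.const 1)))
          (.assign 17 (.var 3) (entry 14 (.var 3) (.var 2)))))
      .skip)
    .skip

/-- All agents propose, until nothing changes any more. -/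
def rounds : Cmd := .loop 7 (.loop 8 (.loop 9 (.loop 2 (.loop 3 proposal))))

/-- Initialise the bounds. -/
def copyBounds : Cmd :=
  .loop 2 (.seq (.assign 16 (.var 2) (.const 0)) (.assign 17 (.var 2) (.cell 15 (.var 2))))

/-- Raise the flag if the lower bound of some agent exceeds the upper bound. -/
def validate : Cmd :=
  .loop 2 (.ite (.sub numAgents (.var 2))
    (.ite (.sub (.cell 16 (.var 2)) (.cell 17 (.var 2))) (.assign 10 (.const 0) (.const 1)) .skip)
    .skip)

/-- Try to improve the upper bound of the agent in bank `5`. -/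
def tryLower : Cmd :=
  .seq copyBounds (.seq (.assign 17 (.var 5) (.sub (.cell 17 (.var 5)) (.const 1)))
    (.seq rounds (.seq (.assign 10 (.const 0) (.const 0)) (.seq validate
      (.ite (.var 10) .skip (.loop 2 (.assign 15 (.var 2) (.cell 17 (.var 2)))))))))

/-- Improve all upper bounds as much as possible. -/
def lowerAll : Cmd := .loop 5 (.loop 6 (.ite (.sub numAgents (.var 5)) tryLower .skip))

/-- Check whether the upper bounds of two agents are in conflict, and record a possible pair. -/
def verifyPair : Cmd :=
  .ite (.sub numAgents (.var 2))
    (.ite (.sub numAgents (.var 3))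
      (.ite (dist (entry 14 (.var 2) (.var 3)) (.cell 15 (.var 2)))
        (.ite (.sub (.cell 15 (.var 2)) (entry 14 (.var 2) (.var 3)))
          (.ite (.sub (.cell 15 (.var 3)) (entry 14 (.var 3) (.var 2)))
            (.assign 10 (.const 0) (.const 1)) .skip)
          .skip)
        (.seq (.ite (dist (entry 14 (.var 3) (.var 2)) (.cell 15 (.var 3)))
            (.assign 10 (.const 0) (.const 1)) .skip)
          (.ite (dist (.var 2) (.var 3))
            (.assign 1 (.add (.var 2) (.const 2)) (.add (.var 3) (.const 1)))
            (.assign 1 (.add (.var 2) (.const 2)) (.const 0)))))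
      .skip)
    .skip

/-- Check whether the upper bounds are attained by a stable matching, and write it down. -/
def verify : Cmd := .loop 2 (.loop 3 verifyPair)

/-- Find a stable matching, given the table of strict ranks. -/
def solve : Cmd :=
  .seq (.loop 2 (.assign 15 (.var 2) (.sub numAgents (.const 1))))
    (.seq lowerAll (.seq (.assign 10 (.const 0) (.const 0)) (.seq verify
      (.ite (.var 10)
        (.seq (.assign 1 (.const 0) (.const 1)) (.assign 1 (.const 1) (.const 0)))
        (.seq (.assign 1 (.const 0) (.add numAgents (.const 1)))
          (.assign 1 (.const 1) (.const 1)))))))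

/-- The whole program. -/
def main (width rk : Term) : Cmd :=
  .seq (offsets width) (.seq (keys rk) (.seq strictRanks solve))

theorem wf_main (width rk : Term) : (main width rk).WF := by
  simp [main, offsets, keys, strictRanks, countBefore, solve, lowerAll, tryLower, copyBounds,
    rounds, proposal, validate, verify, verifyPair, Cmd.WF, Cmd.writes]

/-! ### Correctness of the proposals -/

/-- The precomputed tables: `n` agents, rows of length `N`, and strict ranks `R`. -/
structure Tables (n N : ℕ) (R : Fin n → Fin n → ℕ) (s : Store) : Prop where
  length : s 0 0 = N
  agents : s 0 1 = n
  lt : n < N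
  offset : ∀ x < N, s 11 x = x * N
  rank : ∀ x y : Fin n, s 14 (x * N + y) = R x y

theorem Tables.congr {n N : ℕ} {R : Fin n → Fin n → ℕ} {s s' : Store} (h : Tables n N R s)
    (h0 : s' 0 = s 0) (h11 : s' 11 = s 11) (h14 : s' 14 = s 14) : Tables n N R s' := by
  refine ⟨?_, ?_, h.lt, ?_, ?_⟩
  · rw [h0, h.length]
  · rw [h0, h.agents]
  · rw [h11]; exact h.offset
  · rw [h14]; exact h.rank

/-- The bounds that are stored in the memory. -/
def bounds (n : ℕ) (s : Store) : (Fin n → ℕ) × (Fin n → ℕ) := (fun x => s 16 x, fun x => s 17 x)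

theorem bounds_write {n : ℕ} {s : Store} {b i x : ℕ} (h : b ≠ 16) (h' : b ≠ 17) :
    bounds n (s.write b i x) = bounds n s := by
  unfold bounds
  rw [Store.write_of_ne _ h.symm, Store.write_of_ne _ h'.symm]

section

variable {n N : ℕ} {R : Fin n → Fin n → ℕ}

theorem bounds_proposal {s : Store} (h : Tables n N R s) (x y : Fin n) (hx : s 2 0 = x)
    (hy : s 3 0 = y) : bounds n (proposal.den s) = propose R x y (bounds n s) := by
  have hxN := x.2.trans h.lt
  have hyN := y.2.trans h.lt
  have e1 : n - (x : ℕ) ≠ 0 := by have := x.2; omega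
  have e2 : n - (y : ℕ) ≠ 0 := by have := y.2; omega
  simp only [proposal, Cmd.den, Term.eval, hx, hy, h.agents, h.offset _ hxN, h.offset _ hyN,
    h.rank, e1, e2, ne_eq, not_false_eq_true, if_true]
  by_cases h1 : R x y = s 16 x
  · have d1 : R x y - s 16 x + (s 16 x - R x y) = 0 := by omega
    by_cases h2 : R y x ≤ s 17 y
    · have d2 : R y x - s 17 y = 0 := by omega
      rw [propose, if_pos (show R x y = (bounds n s).1 x from h1),
        if_pos (show R y x ≤ (bounds n s).2 y from h2)]
      simp only [d1, d2, not_true, if_false]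
      unfold bounds
      refine Prod.ext (funext fun a => ?_) (funext fun a => ?_)
      · simp [Store.write_apply]
      · simp [Store.write_apply, Function.update_apply, Fin.ext_iff]
    · have d2 : R y x - s 17 y ≠ 0 := by omega
      rw [propose, if_pos (show R x y = (bounds n s).1 x from h1),
        if_neg (show ¬ R y x ≤ (bounds n s).2 y from h2)]
      simp only [d1, d2, not_true, if_false, not_false_eq_true, if_true]
      unfold bounds
      refine Prod.ext (funext fun a => ?_) (funext fun a => ?_)
      · simp [Store.write_apply, Function.update_apply, Fin.ext_iff]
      · simp [Store.write_apply]
  · have d1 : R x y - s 16 x + (s 16 x - R x y) ≠ 0 := by omega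
    rw [propose, if_neg (show ¬ R x y = (bounds n s).1 x from h1)]
    simp only [d1, not_false_eq_true, if_true]

theorem proposal_eq_self {s : Store} (h : s 0 1 = n) (hxy : n ≤ s 2 0 ∨ n ≤ s 3 0) :
    proposal.den s = s := by
  simp only [proposal, Cmd.den, Term.eval, h]
  by_cases h1 : n - s 2 0 = 0
  · rw [if_neg (by simpa using h1)]
  · rw [if_pos h1, if_neg (by omega)]

theorem wf_sweep : (Cmd.loop 2 (.loop 3 proposal)).WF := by
  simp [proposal, Cmd.WF, Cmd.writes]

/-- A sweep tries every pair of agents. Unless progress is made, the bounds never change during the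
sweep, and then every single proposal has been tested on the same bounds. -/
theorem bounds_sweep (hR : ∀ x, Function.Injective (R x)) (hn : ∀ x y, R x y < n)
    {r₀ : Fin n → ℕ} (hr₀ : ∀ x, r₀ x ≤ n) {s : Store} (h : Tables n N R s)
    (hs : Reached R n r₀ (bounds n s)) :
    Reached R n r₀ (bounds n ((Cmd.loop 2 (.loop 3 proposal)).den s)) ∧
    ((∀ x y, propose R x y (bounds n s) = bounds n s) →
      bounds n ((Cmd.loop 2 (.loop 3 proposal)).den s) = bounds n s) ∧
    ((∀ x y, propose R x y (bounds n s) = bounds n s) ∨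
      progress n (bounds n s) <
        progress n (bounds n ((Cmd.loop 2 (.loop 3 proposal)).den s))) := by
  have main := den_loop_loop_of_invariant wf_sweep s
    (fun k s' => Reached R n r₀ (bounds n s') ∧
      ((∀ x y, propose R x y (bounds n s) = bounds n s) → bounds n s' = bounds n s) ∧
      ((bounds n s' = bounds n s ∧ ∀ x y : Fin n, x * N + y < k →
          propose R x y (bounds n s) = bounds n s) ∨
        progress n (bounds n s) < progress n (bounds n s')))
    (fun k s' x hk => by rwa [bounds_write (by decide) (by decide)])
    (fun k s' x hk => by rwa [bounds_write (by decide) (by decide)])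
    ⟨hs, fun _ => rfl, Or.inl ⟨rfl, fun _ _ hk => absurd hk (Nat.not_lt_zero _)⟩⟩
    (fun x y s' hx hy h1 h2 h3 hf => ?_)
  · refine ⟨main.1, main.2.1, main.2.2.imp_left fun h1 x y => h1.2 x y ?_⟩
    rw [h.length]
    have := x.2.trans h.lt
    have := y.2.trans h.lt
    nlinarith
  · rw [h.length] at hx hy h1 ⊢
    have h' : Tables n N R s' := h.congr (hf 0 (by simp [proposal, Cmd.writes]))
      (hf 11 (by simp [proposal, Cmd.writes])) (hf 14 (by simp [proposal, Cmd.writes]))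
    by_cases hxy : x < n ∧ y < n
    · obtain ⟨hxn, hyn⟩ := hxy
      have e := bounds_proposal h' ⟨x, hxn⟩ ⟨y, hyn⟩ h2 h3
      rw [e]
      refine ⟨h1.1.propose hR hn _ _, fun hfix => ?_, ?_⟩
      · rw [h1.2.1 hfix, hfix]
      · have hp := progress_propose (R := R) (fun a => (h1.1.le a).trans (hr₀ a))
          ⟨x, hxn⟩ ⟨y, hyn⟩
        rcases h1.2.2 with ⟨h4, h5⟩ | h4
        · rw [h4] at hp ⊢
          rcases hp with hp | hp
          · left
            refine ⟨hp, fun a b hab => ?_⟩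
            rcases Nat.lt_succ_iff_lt_or_eq.1 hab with hab | hab
            · exact h5 a b hab
            · obtain ⟨ha, hb⟩ := Nat.mul_add_inj (b.2.trans h.lt) hy hab
              have ha' : a = ⟨x, hxn⟩ := Fin.ext ha
              have hb' : b = ⟨y, hyn⟩ := Fin.ext hb
              rw [ha', hb', hp]
          · exact Or.inr hp
        · right
          rcases hp with hp | hp
          · rwa [hp]
          · exact h4.trans hp
    · rw [proposal_eq_self h'.agents (by omega)]
      refine ⟨h1.1, h1.2.1, h1.2.2.imp_left fun h4 => ⟨h4.1, fun a b hab => ?_⟩⟩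
      rcases Nat.lt_succ_iff_lt_or_eq.1 hab with hab | hab
      · exact h4.2 a b hab
      · obtain ⟨ha, hb⟩ := Nat.mul_add_inj (b.2.trans h.lt) hy hab
        exact absurd ⟨ha ▸ a.2, hb ▸ b.2⟩ hxy

theorem wf_rounds : rounds.WF := by
  simp [rounds, proposal, Cmd.WF, Cmd.writes]

/-- Each sweep makes progress or starts from a fixed point, which then persists. There are more
sweeps than the progress measure allows. -/
theorem bounds_rounds (hR : ∀ x, Function.Injective (R x)) (hn : ∀ x y, R x y < n)
    {r₀ : Fin n → ℕ} (hr₀ : ∀ x, r₀ x ≤ n) {s : Store} (h : Tables n N R s)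
    (hs : Reached R n r₀ (bounds n s)) :
    Reached R n r₀ (bounds n (rounds.den s)) ∧
      ∀ x y, propose R x y (bounds n (rounds.den s)) = bounds n (rounds.den s) := by
  have h0 := h.length
  have main := den_loop_of_invariant' wf_rounds s
    (fun k s' => Reached R n r₀ (bounds n s') ∧
      (k * (N * N) ≤ progress n (bounds n s') ∨
        ∀ x y, propose R x y (bounds n s') = bounds n s'))
    (fun k s' x hk => by rwa [bounds_write (by decide) (by decide)])
    ⟨hs, Or.inl (by simp)⟩ (fun j s' hj h1 h2 hf => ?_)
  · refine ⟨main.1, main.2.resolve_left fun h1 => ?_⟩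
    have h2 := main.1.progress_le
    rw [Fintype.card_fin] at h2
    rw [h0] at h1
    have h3 := h.lt
    -- Progress is at most `2 * n ^ 2`, which is less than `(n + 1) ^ 3`, hence less than the number
    -- of sweeps.
    have h4 : (n + 1) * ((n + 1) * (n + 1)) ≤ N * (N * N) :=
      Nat.mul_le_mul h3 (Nat.mul_le_mul h3 h3)
    change N * (N * N) ≤ progress n (bounds n (rounds.den s)) at h1
    change progress n (bounds n (rounds.den s)) ≤ _ at h2
    nlinarith [Nat.zero_le (n * n * n)]
  · have h' : Tables n N R s' := h.congr (hf 0 (by simp [proposal, Cmd.writes]))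
      (hf 11 (by simp [proposal, Cmd.writes])) (hf 14 (by simp [proposal, Cmd.writes]))
    have inner := den_loop_loop_of_invariant wf_rounds.2.2 s'
      (fun k s'' => Reached R n r₀ (bounds n s'') ∧
        (j * (N * N) + k ≤ progress n (bounds n s'') ∨
          ∀ x y, propose R x y (bounds n s'') = bounds n s''))
      (fun k s' x hk => by rwa [bounds_write (by decide) (by decide)])
      (fun k s' x hk => by rwa [bounds_write (by decide) (by decide)])
      (by simpa using h1) (fun x y s'' hx hy h3 h4 h5 hf' => ?_)
    · rw [h'.length] at inner
      rwa [Nat.succ_mul]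
    · have h'' : Tables n N R s'' := h'.congr (hf' 0 (by simp [proposal, Cmd.writes]))
        (hf' 11 (by simp [proposal, Cmd.writes])) (hf' 14 (by simp [proposal, Cmd.writes]))
      obtain ⟨h6, h7, h8⟩ := bounds_sweep hR hn hr₀ h'' h3.1
      refine ⟨h6, ?_⟩
      rcases h8 with h8 | h8
      · right
        rw [h7 h8]
        exact h8
      · rcases h3.2 with h9 | h9
        · left; omega
        · right
          rw [h7 h9]
          exact h9

end

end Solver

end RAM

/-! ### The two outcomes of a tentative decrease -/

namespace StrictRoommates

variable {A : Type*} [DecidableEq A] {R : A → A → ℕ} {n : ℕ} {rc : A → ℕ} {w : A}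
  {p : (A → ℕ) × (A → ℕ)}

theorem Reached.snd_le (h : Reached R n (Function.update rc w (rc w - 1)) p) (x : A) :
    p.2 x ≤ rc x := by
  refine (h.le x).trans ?_
  by_cases hx : x = w
  · subst hx; rw [Function.update_self]; omega
  · rw [Function.update_of_ne hx]

theorem Reached.snd_le_sub_one (h : Reached R n (Function.update rc w (rc w - 1)) p) :
    p.2 w ≤ rc w - 1 := by
  simpa using h.le w

/-- The stable involution `m` need not obey any bound: `Table.exists_stable` moves it below the new
ones. -/
theorem Reached.exists_stable_of_valid [Finite A] (hR : ∀ x, Function.Injective (R x))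
    (hsurj : ∀ x, ∀ k < n, ∃ y, R x y = k)
    (h : Reached R n (Function.update rc w (rc w - 1)) p)
    (hp : ∀ x y, StrictRoommates.propose R x y p = p) (hv : ∀ x, p.1 x ≤ p.2 x)
    (hrc : ∀ x, rc x < n) {m : A → A} (hm : Stable R m) :
    ∃ m', Stable R m' ∧ ∀ x, R x (m' x) ≤ p.2 x :=
  (h.table hp hv).exists_stable hR
    (fun x => hsurj x _ (((hv x).trans (h.snd_le x)).trans_lt (hrc x))) hm

/-- A stable involution below the decreased bounds would lie between the lower and the upper bounds
of every agent, by soundness of the proposals. -/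
theorem Reached.rank_eq_of_not_valid (h : Reached R n (Function.update rc w (rc w - 1)) p)
    (hv : ¬ ∀ x, p.1 x ≤ p.2 x) {m : A → A} (hm : Stable R m) (hle : ∀ x, R x (m x) ≤ rc x) :
    R w (m w) = rc w := by
  by_contra hne
  refine hv fun x => ?_
  have := h.sound m hm (fun x => ?_) x
  · exact this.1.trans this.2
  · by_cases hx : x = w
    · subst hx
      rw [Function.update_self]
      have := hle x
      omega
    · rw [Function.update_of_ne hx]
      exact hle x

end StrictRoommates

/-! ### Lowering the upper bounds until they are tight -/

namespace RAM.Solver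

open Cmd StrictRoommates

variable {n N : ℕ} {R : Fin n → Fin n → ℕ}

/-- The upper bounds in bank `15`. -/
def upper (n : ℕ) (s : Store) : Fin n → ℕ := fun x => s 15 x

theorem upper_write {s : Store} {b i x : ℕ} (h : b ≠ 15) :
    upper n (s.write b i x) = upper n s := by
  unfold upper
  rw [Store.write_of_ne _ h.symm]

theorem copyBounds_spec (s : Store) : ∀ x < s 0 0,
    copyBounds.den s 16 x = 0 ∧ copyBounds.den s 17 x = s 15 x := by
  refine den_loop_of_invariant' (by simp [Cmd.WF, Cmd.writes]) s
    (fun k s' => ∀ x < k, s' 16 x = 0 ∧ s' 17 x = s 15 x) (fun k s' x hk => ?_)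
    (fun x hx => absurd hx (Nat.not_lt_zero _)) (fun j s' hj h1 h2 hf x hx => ?_)
  · simpa [Store.write_apply] using hk
  · have h15 : s' 15 = s 15 := hf 15 (by simp [Cmd.writes])
    simp only [Cmd.den, Term.eval, Store.write_apply, h2, h15]
    rcases Nat.lt_succ_iff_lt_or_eq.1 hx with hx | rfl
    · simpa [hx.ne] using h1 x hx
    · simp

theorem validate_spec {s : Store} (h : Tables n N R s) (h10 : s 10 0 = 0) :
    validate.den s 10 0 = 0 ↔ ∀ x, (bounds n s).1 x ≤ (bounds n s).2 x := by
  have main := den_loop_of_invariant' (v := 2)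
    (p := .ite (.sub numAgents (.var 2))
      (.ite (.sub (.cell 16 (.var 2)) (.cell 17 (.var 2))) (.assign 10 (.const 0) (.const 1)) .skip)
      .skip) (by simp [Cmd.WF, Cmd.writes]) s
    (fun k s' => s' 10 0 = 0 ↔ ∀ x < k, x < n → s 16 x ≤ s 17 x) (fun k s' x hk => ?_)
    (by simp [h10]) (fun j s' hj h1 h2 hf => ?_)
  · refine main.trans ⟨fun h1 x => h1 x ?_ x.2, fun h1 x _ hx => h1 ⟨x, hx⟩⟩
    rw [h.length]
    exact x.2.trans h.lt
  · simpa [Store.write_apply] using hk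
  · have h0 : s' 0 = s 0 := hf 0 (by simp [Cmd.writes])
    have h16 : s' 16 = s 16 := hf 16 (by simp [Cmd.writes])
    have h17 : s' 17 = s 17 := hf 17 (by simp [Cmd.writes])
    have split : (∀ x < j + 1, x < n → s 16 x ≤ s 17 x) ↔
        (∀ x < j, x < n → s 16 x ≤ s 17 x) ∧ (j < n → s 16 j ≤ s 17 j) := by
      refine ⟨fun h3 => ⟨fun x hx => h3 x (by omega), h3 j (by omega)⟩, fun h3 x hx hxn => ?_⟩
      rcases Nat.lt_succ_iff_lt_or_eq.1 hx with hx | rfl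
      · exact h3.1 x hx hxn
      · exact h3.2 hxn
    rw [split, ← h1]
    have e1 : (Term.sub numAgents (.var 2)).eval s' = n - j := by
      simp [Term.eval, h0, h2, h.agents]
    have e2 : (Term.sub (.cell 16 (.var 2)) (.cell 17 (.var 2))).eval s' = s 16 j - s 17 j := by
      simp [Term.eval, h16, h17, h2]
    by_cases h3 : j < n
    · rw [den_ite_of_ne (by omega)]
      by_cases h4 : s 16 j ≤ s 17 j
      · rw [den_ite_of_eq (by omega)]; simp [h4, Cmd.den]
      · rw [den_ite_of_ne (by omega)]; simp [h4, h3, Cmd.den, Store.write_apply, Term.eval]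
    · rw [den_ite_of_eq (by omega)]; simp [h3, Cmd.den]

theorem copy_spec (s : Store) : ∀ x < s 0 0,
    (Cmd.loop 2 (.assign 15 (.var 2) (.cell 17 (.var 2)))).den s 15 x = s 17 x := by
  refine den_loop_of_invariant' (by simp [Cmd.WF, Cmd.writes]) s
    (fun k s' => ∀ x < k, s' 15 x = s 17 x) (fun k s' x hk => ?_)
    (fun x hx => absurd hx (Nat.not_lt_zero _)) (fun j s' hj h1 h2 hf x hx => ?_)
  · simpa [Store.write_apply] using hk
  · have h17 : s' 17 = s 17 := hf 17 (by simp [Cmd.writes])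
    simp only [Cmd.den, Term.eval, Store.write_apply, h2, h17]
    rcases Nat.lt_succ_iff_lt_or_eq.1 hx with hx | rfl
    · simpa [hx.ne] using h1 x hx
    · simp

theorem Tables.den {s : Store} (h : Tables n N R s) (c : Cmd) (h0 : 0 ∉ c.writes)
    (h11 : 11 ∉ c.writes) (h14 : 14 ∉ c.writes) : Tables n N R (c.den s) :=
  h.congr (den_of_notMem_writes c s h0) (den_of_notMem_writes c s h11)
    (den_of_notMem_writes c s h14)

/-- Valid bounds after the proposals are adopted, invalid ones are discarded; in the latter case the
bound of `w` is tight for every stable involution below the current bounds. -/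
theorem tryLower_spec (hR : ∀ x, Function.Injective (R x)) (hn : ∀ x y, R x y < n)
    (hsurj : ∀ x, ∀ k < n, ∃ y, R x y = k) {s : Store} (h : Tables n N R s)
    {w : Fin n} (hw : s 5 0 = w) (hrc : ∀ x, upper n s x < n) :
    ((∃ m, Stable R m ∧ ∀ x, R x (m x) ≤ upper n s x) →
      ∃ m, Stable R m ∧ ∀ x, R x (m x) ≤ upper n (tryLower.den s) x) ∧
    (∀ x, upper n (tryLower.den s) x ≤ upper n s x) ∧
    (upper n (tryLower.den s) w < upper n s w ∨
      ∀ m, Stable R m → (∀ x, R x (m x) ≤ upper n s x) → R w (m w) = upper n s w) := by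
  have hN : s 0 0 = N := h.length
  have c1 := copyBounds_spec s
  have t1 : Tables n N R (copyBounds.den s) := h.den _ (by simp [copyBounds, Cmd.writes])
    (by simp [copyBounds, Cmd.writes]) (by simp [copyBounds, Cmd.writes])
  have w1 : copyBounds.den s 5 0 = w := by
    rw [den_of_notMem_writes _ _ (by simp [copyBounds, Cmd.writes]), hw]
  have u1 : copyBounds.den s 15 = s 15 :=
    den_of_notMem_writes _ _ (by simp [copyBounds, Cmd.writes])
  have hden : tryLower.den s = (Cmd.ite (.var 10) .skip
      (.loop 2 (.assign 15 (.var 2) (.cell 17 (.var 2))))).den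
      (validate.den ((rounds.den ((copyBounds.den s).write 17 w
        (copyBounds.den s 17 w - 1))).write 10 0 0)) := by
    rw [← w1]; rfl
  rw [hden]
  generalize copyBounds.den s = s1 at c1 t1 w1 u1
  have t2 : Tables n N R (s1.write 17 w (s1 17 w - 1)) := t1.congr
    (Store.write_of_ne _ (by decide) _ _) (Store.write_of_ne _ (by decide) _ _)
    (Store.write_of_ne _ (by decide) _ _)
  have b2 : bounds n (s1.write 17 w (s1 17 w - 1)) =
      (fun _ => 0, Function.update (upper n s) w (upper n s w - 1)) := by
    have c2 := fun x : Fin n => c1 x (by rw [hN]; exact x.2.trans h.lt)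
    refine Prod.ext (funext fun x => ?_) (funext fun x => ?_)
    · simp [bounds, Store.write_apply, c2]
    · simp [bounds, Store.write_apply, c2, Function.update_apply, Fin.ext_iff, upper]
  have u2 : (s1.write 17 w (s1 17 w - 1)) 15 = s 15 := by
    rw [Store.write_of_ne _ (by decide), u1]
  generalize s1.write 17 w (s1 17 w - 1) = s2 at t2 b2 u2
  obtain ⟨r3, f3⟩ := bounds_rounds hR hn (r₀ := Function.update (upper n s) w (upper n s w - 1))
    (fun x => by
      have := hrc x
      by_cases hx : x = w
      · subst hx; rw [Function.update_self]; omega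
      · rw [Function.update_of_ne hx]; omega) t2 (by rw [b2]; exact Reached.init _ _ _)
  have t3 : Tables n N R (rounds.den s2) := t2.den _ (by simp [rounds, proposal, Cmd.writes])
    (by simp [rounds, proposal, Cmd.writes]) (by simp [rounds, proposal, Cmd.writes])
  have u3 : rounds.den s2 15 = s 15 := by
    rw [den_of_notMem_writes _ _ (by simp [rounds, proposal, Cmd.writes]), u2]
  generalize rounds.den s2 = s3 at r3 f3 t3 u3
  have t4 : Tables n N R (s3.write 10 0 0) := t3.congr
    (Store.write_of_ne _ (by decide) _ _) (Store.write_of_ne _ (by decide) _ _)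
    (Store.write_of_ne _ (by decide) _ _)
  have v4 := validate_spec t4 (by simp [Store.write_apply])
  have u4 : validate.den (s3.write 10 0 0) 15 = s 15 := by
    rw [den_of_notMem_writes _ _ (by simp [validate, Cmd.writes]),
      Store.write_of_ne _ (by decide), u3]
  have a4 : validate.den (s3.write 10 0 0) 17 = s3 17 := by
    rw [den_of_notMem_writes _ _ (by simp [validate, Cmd.writes]),
      Store.write_of_ne _ (by decide)]
  have l4 : validate.den (s3.write 10 0 0) 0 0 = N := by
    rw [den_of_notMem_writes _ _ (by simp [validate, Cmd.writes]), t4.length]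
  rw [bounds_write (by decide) (by decide)] at v4
  generalize validate.den (s3.write 10 0 0) = s5 at v4 u4 a4 l4
  by_cases hv : ∀ x, (bounds n s3).1 x ≤ (bounds n s3).2 x
  · rw [den_ite_of_eq (e := .var 10) (by exact v4.2 hv)]
    have c := copy_spec s5
    have e : upper n ((Cmd.loop 2 (.assign 15 (.var 2) (.cell 17 (.var 2)))).den s5) =
        (bounds n s3).2 := by
      funext x
      have := c x (by rw [l4]; exact x.2.trans h.lt)
      rw [a4] at this
      exact this
    rw [e]
    refine ⟨fun ⟨m, hm, _⟩ => r3.exists_stable_of_valid hR hsurj f3 hv hrc hm, r3.snd_le, ?_⟩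
    have := r3.snd_le_sub_one
    -- At `0` the truncated decrease has no effect, but then the bound is trivially tight.
    by_cases h0 : upper n s w = 0
    · right
      intro m _ hm
      have := hm w
      omega
    · left; omega
  · rw [den_ite_of_ne (e := .var 10) (by exact mt v4.1 hv), Cmd.den]
    have e : upper n s5 = upper n s := by unfold upper; rw [u4]
    rw [e]
    exact ⟨id, fun _ => le_rfl, Or.inr fun m hm hle => r3.rank_eq_of_not_valid hv hm hle⟩

/-- In the invariant, `k - y * N` counts the iterations since the turn of `y` began, and is `0`
before. Each try lowers the bound of `y` or shows it tight. As `y` has `N > n` tries, its bound must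
become tight. -/
theorem lowerAll_spec (hR : ∀ x, Function.Injective (R x)) (hn : ∀ x y, R x y < n)
    (hsurj : ∀ x, ∀ k < n, ∃ y, R x y = k) {s : Store} (h : Tables n N R s)
    (hrc : ∀ x, upper n s x = n - 1) :
    (∀ x, upper n (lowerAll.den s) x < n) ∧
    ((∃ m, Stable R m) → ∃ m, Stable R m ∧ ∀ x, R x (m x) = upper n (lowerAll.den s) x) := by
  have main := den_loop_loop_of_invariant (v := 5) (w := 6)
    (p := .ite (.sub numAgents (.var 5)) tryLower .skip)
    (by simp [tryLower, copyBounds, rounds, proposal, validate, Cmd.WF, Cmd.writes]) s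
    (fun k s' => (∀ x, upper n s' x < n) ∧
      ((∃ m, Stable R m) → ∃ m, Stable R m ∧ ∀ x, R x (m x) ≤ upper n s' x) ∧
      ∀ y : Fin n, upper n s' y + (k - y * N) < n ∨
        ∀ m, Stable R m → (∀ x, R x (m x) ≤ upper n s' x) → R y (m y) = upper n s' y)
    (fun k s' x hk => by rwa [upper_write (by decide)])
    (fun k s' x hk => by rwa [upper_write (by decide)])
    ⟨fun x => ?_, ?_, fun y => ?_⟩ (fun x y s' hx hy h1 h2 h3 hf => ?_)
  · refine ⟨main.1, fun hex => ?_⟩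
    obtain ⟨m, hm, hle⟩ := main.2.1 hex
    refine ⟨m, hm, fun y => (main.2.2 y).resolve_left (fun h1 => ?_) m hm hle⟩
    rw [h.length] at h1
    have h2 : (y + 1) * N ≤ N * N := Nat.mul_le_mul_right _ (y.2.trans h.lt)
    rw [Nat.succ_mul] at h2
    have := h.lt
    omega
  · rw [hrc]; have := x.2; omega
  · rintro ⟨m, hm⟩
    refine ⟨m, hm, fun x => ?_⟩
    rw [hrc]
    have := hn x (m x)
    omega
  · left
    rw [hrc]
    have := y.2
    omega
  · rw [h.length] at hx hy h1 ⊢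
    have t' : Tables n N R s' := h.congr
      (hf 0 (by simp [tryLower, copyBounds, rounds, proposal, validate, Cmd.writes]))
      (hf 11 (by simp [tryLower, copyBounds, rounds, proposal, validate, Cmd.writes]))
      (hf 14 (by simp [tryLower, copyBounds, rounds, proposal, validate, Cmd.writes]))
    have e1 : (Term.sub numAgents (.var 5)).eval s' = n - x := by
      simp [Term.eval, t'.agents, h2]
    have mono : ∀ {a b : ℕ}, a < b → a * N + N ≤ b * N := by
      intro a b hab
      have := Nat.mul_le_mul_right N hab
      rwa [Nat.succ_mul] at this
    by_cases hxn : x < n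
    · rw [den_ite_of_ne (by omega)]
      obtain ⟨h4, h5, h6⟩ := tryLower_spec hR hn hsurj t' (w := ⟨x, hxn⟩) h2 h1.1
      generalize tryLower.den s' = s'' at h4 h5 h6
      refine ⟨fun z => (h5 z).trans_lt (h1.1 z), fun hex => h4 (h1.2.1 hex), fun z => ?_⟩
      -- Tightness survives later decreases for any agent: obeying the smaller bounds implies
      -- obeying the older ones, so the rank equals the old bound and the new bound lies in between.
      have persist : (∀ m, Stable R m → (∀ x, R x (m x) ≤ upper n s' x) →
          R z (m z) = upper n s' z) → ∀ m, Stable R m → (∀ x, R x (m x) ≤ upper n s'' x) →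
          R z (m z) = upper n s'' z := by
        intro h7 m hm hle
        have h8 := h7 m hm fun x => (hle x).trans (h5 x)
        have h9 := hle z
        have := h5 z
        omega
      rcases h1.2.2 z with h7 | h7
      · rcases lt_trichotomy (z : ℕ) x with hz | hz | hz
        · have := mono hz
          have := h.lt
          omega
        · have hz' : z = ⟨x, hxn⟩ := Fin.ext hz
          rcases h6 with h6 | h6
          · left
            rw [← hz'] at h6
            rw [hz] at h7 ⊢
            omega
          · right
            exact persist (hz' ▸ h6)
        · left
          have := mono hz
          have := h5 z
          have := h1.1 z
          omega
      · exact Or.inr (persist h7)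
    · rw [den_ite_of_eq (by omega), Cmd.den]
      refine ⟨h1.1, h1.2.1, fun z => ?_⟩
      rcases h1.2.2 z with h7 | h7
      · have hz : (z : ℕ) < x := by have := z.2; omega
        have := mono hz
        have := h.lt
        omega
      · exact Or.inr h7

end RAM.Solver

/-! ### Verifying the candidate and writing the answer -/

namespace RAM.Solver

open Cmd StrictRoommates

variable {n N : ℕ} {R : Fin n → Fin n → ℕ}

/-- The pair `x`, `y` shows that the bounds `r` are not attained by a stable matching. -/
def Conflict (R : Fin n → Fin n → ℕ) (r : Fin n → ℕ) (x y : Fin n) : Prop :=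
  (R x y = r x ∧ R y x ≠ r y) ∨ (R x y < r x ∧ R y x < r y)

/-- The loops inspect all ordered pairs. The flag collects the conflicts, and the pair that attains
the bound of `x` writes the entry of `x`. -/
theorem verify_spec (hR : ∀ x, Function.Injective (R x)) {s : Store} (h : Tables n N R s)
    (h10 : s 10 0 = 0) :
    (verify.den s 10 0 = 0 ↔ ∀ x y, ¬ Conflict R (upper n s) x y) ∧
    ∀ x y : Fin n, R x y = upper n s x →
      verify.den s 1 (x + 2) = if y = x then 0 else (y : ℕ) + 1 := by
  have main := den_loop_loop_of_invariant (v := 2) (w := 3) (p := verifyPair)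
    (by simp [verifyPair, Cmd.WF, Cmd.writes]) s
    (fun k s' => (s' 10 0 = 0 ↔ ∀ x y : Fin n, x * N + y < k → ¬ Conflict R (upper n s) x y) ∧
      ∀ x y : Fin n, x * N + y < k → R x y = upper n s x →
        s' 1 (x + 2) = if y = x then 0 else (y : ℕ) + 1)
    (fun k s' x hk => by simpa [Store.write_apply] using hk)
    (fun k s' x hk => by simpa [Store.write_apply] using hk) (by simp [h10])
    (fun x y s' hx hy h1 h2 h3 hf => ?_)
  · change (verify.den s 10 0 = 0 ↔ _) ∧ _ at main
    rw [h.length] at main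
    have hlt : ∀ x y : Fin n, (x : ℕ) * N + y < N * N := by
      intro x y
      have := x.2.trans h.lt
      have := y.2.trans h.lt
      nlinarith
    exact ⟨main.1.trans ⟨fun h1 x y => h1 x y (hlt x y), fun h1 x y _ => h1 x y⟩,
      fun x y => main.2 x y (hlt x y)⟩
  · rw [h.length] at hx hy h1 ⊢
    have t : Tables n N R s' := h.congr (hf 0 (by simp [verifyPair, Cmd.writes]))
      (hf 11 (by simp [verifyPair, Cmd.writes])) (hf 14 (by simp [verifyPair, Cmd.writes]))
    have h15 : s' 15 = s 15 := hf 15 (by simp [verifyPair, Cmd.writes])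
    have split : ∀ P : Fin n → Fin n → Prop,
        (∀ a b : Fin n, (a : ℕ) * N + b < x * N + y + 1 → P a b) ↔
        (∀ a b : Fin n, (a : ℕ) * N + b < x * N + y → P a b) ∧
          ∀ (ha : x < n) (hb : y < n), P ⟨x, ha⟩ ⟨y, hb⟩ := by
      intro P
      refine ⟨fun hP => ⟨fun a b hab => hP a b (by omega), fun ha hb => hP _ _ (by simp)⟩,
        fun hP a b hab => ?_⟩
      rcases Nat.lt_succ_iff_lt_or_eq.1 hab with hab | hab
      · exact hP.1 a b hab
      · obtain ⟨ha, hb⟩ := Nat.mul_add_inj (b.2.trans h.lt) hy hab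
        have ha' : a = ⟨x, ha ▸ a.2⟩ := Fin.ext ha
        have hb' : b = ⟨y, hb ▸ b.2⟩ := Fin.ext hb
        rw [ha', hb']
        exact hP.2 _ _
    rw [split, split, ← h1.1]
    have e1 : (Term.sub numAgents (.var 2)).eval s' = n - x := by
      simp [Term.eval, t.agents, h2]
    have e2 : (Term.sub numAgents (.var 3)).eval s' = n - y := by
      simp [Term.eval, t.agents, h3]
    rw [verifyPair]
    by_cases hxy : x < n ∧ y < n
    swap
    · have : ∀ p : Cmd, (Cmd.ite (.sub numAgents (.var 2))
          (.ite (.sub numAgents (.var 3)) p .skip) .skip).den s' = s' := by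
        intro p
        by_cases hxn : x < n
        · rw [den_ite_of_ne (by omega), den_ite_of_eq (by omega), Cmd.den]
        · rw [den_ite_of_eq (by omega), Cmd.den]
      rw [this]
      exact ⟨⟨fun h4 => ⟨h4, fun ha hb => absurd ⟨ha, hb⟩ hxy⟩, fun h4 => h4.1⟩,
        h1.2, fun ha hb => absurd ⟨ha, hb⟩ hxy⟩
    obtain ⟨hxn, hyn⟩ := hxy
    rw [den_ite_of_ne (by omega), den_ite_of_ne (by omega)]
    set x' : Fin n := ⟨x, hxn⟩ with hx'
    set y' : Fin n := ⟨y, hyn⟩ with hy'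
    have h2' : s' 2 0 = x' := h2
    have h3' : s' 3 0 = y' := h3
    have r1 : (entry 14 (.var 2) (.var 3)).eval s' = R x' y' := by
      rw [← t.rank]; simp [Term.eval, h2', h3', t.offset _ (x'.2.trans h.lt)]
    have r2 : (entry 14 (.var 3) (.var 2)).eval s' = R y' x' := by
      rw [← t.rank]; simp [Term.eval, h2', h3', t.offset _ (y'.2.trans h.lt)]
    have r3 : (Term.cell 15 (.var 2)).eval s' = upper n s x' := by
      simp [Term.eval, h2, h15, upper, hx']
    have r4 : (Term.cell 15 (.var 3)).eval s' = upper n s y' := by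
      simp [Term.eval, h3, h15, upper, hy']
    have dist_eval : ∀ (e f : Term) (s : Store), (dist e f).eval s = 0 ↔ e.eval s = f.eval s := by
      intro e f s
      simp only [Term.eval]
      omega
    by_cases hd : R x' y' = upper n s x'
    · rw [den_ite_of_eq (e := dist (entry 14 (.var 2) (.var 3)) _)
        ((dist_eval _ _ _).2 (by rw [r1, r3, hd])), den_seq]
      have hbad : Conflict R (upper n s) x' y' ↔ R y' x' ≠ upper n s y' := by
        unfold Conflict
        refine ⟨fun h4 => h4.elim (fun h5 => h5.2) fun h5 => absurd h5.1 (by omega),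
          fun h4 => Or.inl ⟨hd, h4⟩⟩
      obtain ⟨s'', hs'', f1, f2⟩ : ∃ s'', (Cmd.ite (dist (entry 14 (.var 3) (.var 2))
          (.cell 15 (.var 3))) (.assign 10 (.const 0) (.const 1)) .skip).den s' = s'' ∧
          (s'' 10 0 = 0 ↔ s' 10 0 = 0 ∧ ¬ Conflict R (upper n s) x' y') ∧
          (∀ b, b ≠ 10 → s'' b = s' b) := by
        by_cases hd' : R y' x' = upper n s y'
        · rw [den_ite_of_eq ((dist_eval _ _ _).2 (by rw [r2, r4, hd']))]
          exact ⟨_, rfl, by simp [Cmd.den, hbad, hd'], fun b _ => rfl⟩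
        · rw [den_ite_of_ne (mt (dist_eval _ _ _).1 (by rwa [r2, r4]))]
          refine ⟨_, rfl, by simp [Cmd.den, hbad, hd', Store.write_apply, Term.eval],
            fun b hb => ?_⟩
          exact Store.write_of_ne _ hb _ _
      rw [hs'']
      have g2 : s'' 2 0 = x := by rw [f2 2 (by decide), h2]
      have g3 : s'' 3 0 = y := by rw [f2 3 (by decide), h3]
      have hden : (Cmd.ite (dist (.var 2) (.var 3))
          (.assign 1 (.add (.var 2) (.const 2)) (.add (.var 3) (.const 1)))
          (.assign 1 (.add (.var 2) (.const 2)) (.const 0))).den s'' =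
          s''.write 1 (x + 2) (if y' = x' then 0 else y + 1) := by
        by_cases he : y' = x'
        · have : y = x := congrArg Fin.val he
          rw [den_ite_of_eq ((dist_eval _ _ _).2 (by simp [Term.eval, g2, g3, this])), if_pos he]
          simp [Cmd.den, Term.eval, g2]
        · have : x ≠ y := fun h => he (Fin.ext h.symm)
          rw [den_ite_of_ne (mt (dist_eval _ _ _).1 (by simpa [Term.eval, g2, g3] using this)),
            if_neg he]
          simp [Cmd.den, Term.eval, g2, g3]
      rw [hden]
      refine ⟨?_, fun a b hab hRab => ?_, fun ha hb _ => ?_⟩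
      · simpa [Store.write_apply, hxn, hyn] using f1
      · rw [Store.write_apply]
        -- An entry already written is overwritten only in the row of `a`, and there the candidate
        -- of the given rank is unique.
        by_cases ha : (a : ℕ) = x
        · have ha' : a = x' := Fin.ext ha
          subst ha'
          have hb' : b = y' := hR _ (hRab.trans hd.symm)
          subst hb'
          simp [hx', hy']
        · rw [if_neg (by omega), f2 1 (by decide)]
          exact h1.2 a b hab hRab
      · simp [Store.write_apply, hx', hy']
    · rw [den_ite_of_ne (e := dist (entry 14 (.var 2) (.var 3)) _)
        (mt (dist_eval _ _ _).1 (by rwa [r1, r3]))]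
      have hbad : Conflict R (upper n s) x' y' ↔
          R x' y' < upper n s x' ∧ R y' x' < upper n s y' := by
        unfold Conflict
        exact ⟨fun h4 => h4.elim (fun h5 => absurd h5.1 hd) id, Or.inr⟩
      obtain ⟨s'', hs'', f1, f2⟩ : ∃ s'', (Cmd.ite (.sub (.cell 15 (.var 2))
            (entry 14 (.var 2) (.var 3)))
          (.ite (.sub (.cell 15 (.var 3)) (entry 14 (.var 3) (.var 2)))
            (.assign 10 (.const 0) (.const 1)) .skip) .skip).den s' = s'' ∧
          (s'' 10 0 = 0 ↔ s' 10 0 = 0 ∧ ¬ Conflict R (upper n s) x' y') ∧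
          (∀ b, b ≠ 10 → s'' b = s' b) := by
        have q1 : (Term.sub (.cell 15 (.var 2)) (entry 14 (.var 2) (.var 3))).eval s' =
          upper n s x' - R x' y' := by rw [← r1, ← r3]; rfl
        have q2 : (Term.sub (.cell 15 (.var 3)) (entry 14 (.var 3) (.var 2))).eval s' =
          upper n s y' - R y' x' := by rw [← r2, ← r4]; rfl
        by_cases c1 : R x' y' < upper n s x'
        · rw [den_ite_of_ne (by omega)]
          by_cases c2 : R y' x' < upper n s y'
          · rw [den_ite_of_ne (by omega)]
            exact ⟨_, rfl, by simp [Cmd.den, hbad, c1, c2, Store.write_apply, Term.eval],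
              fun b hb => Store.write_of_ne _ hb _ _⟩
          · rw [den_ite_of_eq (by omega)]
            exact ⟨_, rfl, by simp [Cmd.den, hbad, c2], fun b _ => rfl⟩
        · rw [den_ite_of_eq (by omega)]
          exact ⟨_, rfl, by simp [Cmd.den, hbad, c1], fun b _ => rfl⟩
      rw [hs'']
      refine ⟨?_, fun a b hab hRab => ?_, fun ha hb hRab => absurd hRab hd⟩
      · rw [f1]
        simp [hxn, hyn, hx', hy']
      · rw [f2 1 (by decide)]
        exact h1.2 a b hab hRab

/-- The bounds determine a map, as ranks are injective. Conflicts of the first kind are the failures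
of this map to be an involution, those of the second kind its blocking pairs. -/
theorem exists_stable_iff_not_conflict (hR : ∀ x, Function.Injective (R x)) {r : Fin n → ℕ}
    (hr : ∀ x, ∃ y, R x y = r x) :
    (∀ x y, ¬ Conflict R r x y) ↔ ∃ m, Stable R m ∧ ∀ x, R x (m x) = r x := by
  constructor
  · intro h
    choose m hm using hr
    refine ⟨m, ⟨fun x => ?_, fun x y hxy => ?_⟩, hm⟩
    · by_contra hne
      exact h x (m x) (Or.inl ⟨hm x, fun e => hne (hR (m x) ((hm (m x)).trans e.symm))⟩)
    · rw [hm, hm] at hxy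
      exact h x y (Or.inr hxy)
  · rintro ⟨m, hm, hmr⟩ x y (⟨h1, h2⟩ | h1)
    · rw [← hmr x] at h1
      have := hR x h1
      subst this
      rw [← hmr, hm.invol] at h2
      exact h2 rfl
    · rw [← hmr x, ← hmr y] at h1
      exact hm.not_blocks x y h1

theorem init_upper_spec (s : Store) : ∀ x < s 0 0,
    (Cmd.loop 2 (.assign 15 (.var 2) (.sub numAgents (.const 1)))).den s 15 x = s 0 1 - 1 := by
  refine den_loop_of_invariant' (by simp [Cmd.WF, Cmd.writes]) s
    (fun k s' => ∀ x < k, s' 15 x = s 0 1 - 1) (fun k s' x hk => ?_)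
    (fun x hx => absurd hx (Nat.not_lt_zero _)) (fun j s' hj h1 h2 hf x hx => ?_)
  · simpa [Store.write_apply] using hk
  · have h0 : s' 0 = s 0 := hf 0 (by simp [Cmd.writes])
    simp only [Cmd.den, Term.eval, Store.write_apply, h2, h0]
    rcases Nat.lt_succ_iff_lt_or_eq.1 hx with hx | rfl
    · simpa [hx.ne] using h1 x hx
    · simp

/-- Tight bounds are attained by a stable involution whenever one exists, so a conflict proves that
there is none. -/
theorem solve_spec (hR : ∀ x, Function.Injective (R x)) (hn : ∀ x y, R x y < n) {s : Store}
    (h : Tables n N R s) :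
    (∃ m, Stable R m ∧ output (solve.den s) =
      1 :: List.ofFn fun a => (partnerOf m a).elim 0 fun b => (b : ℕ) + 1) ∨
    ((∀ m, ¬ Stable R m) ∧ output (solve.den s) = [0]) := by
  have hsurj : ∀ x, ∀ k < n, ∃ y, R x y = k := by
    intro x k hk
    have hinj : Function.Injective fun y => (⟨R x y, hn x y⟩ : Fin n) :=
      fun a b hab => hR x (congrArg Fin.val hab)
    obtain ⟨y, hy⟩ := Finite.injective_iff_surjective.1 hinj ⟨k, hk⟩
    exact ⟨y, congrArg Fin.val hy⟩
  simp only [solve, den_seq]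
  have c1 := init_upper_spec s
  have t1 := h.den (Cmd.loop 2 (.assign 15 (.var 2) (.sub numAgents (.const 1))))
    (by simp [Cmd.writes]) (by simp [Cmd.writes]) (by simp [Cmd.writes])
  generalize (Cmd.loop 2 (.assign 15 (.var 2) (.sub numAgents (.const 1)))).den s = s1 at c1 t1
  have u1 : ∀ x, upper n s1 x = n - 1 := fun x => by
    rw [upper, c1 x (by rw [h.length]; exact x.2.trans h.lt), h.agents]
  obtain ⟨l2, e2⟩ := lowerAll_spec hR hn hsurj t1 u1
  have t2 := t1.den lowerAll
    (by simp [lowerAll, tryLower, copyBounds, rounds, proposal, validate, Cmd.writes])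
    (by simp [lowerAll, tryLower, copyBounds, rounds, proposal, validate, Cmd.writes])
    (by simp [lowerAll, tryLower, copyBounds, rounds, proposal, validate, Cmd.writes])
  generalize lowerAll.den s1 = s2 at l2 e2 t2
  have hflag : (Cmd.assign 10 (.const 0) (.const 0)).den s2 = s2.write 10 0 0 := rfl
  rw [hflag]
  have t3 : Tables n N R (s2.write 10 0 0) := t2.congr
    (Store.write_of_ne _ (by decide) _ _) (Store.write_of_ne _ (by decide) _ _)
    (Store.write_of_ne _ (by decide) _ _)
  obtain ⟨v1, v2⟩ := verify_spec hR t3 (by simp [Store.write_apply])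
  rw [upper_write (by decide)] at v1 v2
  have a4 : verify.den (s2.write 10 0 0) 0 1 = n := by
    rw [den_of_notMem_writes _ _ (by simp [verify, verifyPair, Cmd.writes]), t3.agents]
  generalize verify.den (s2.write 10 0 0) = s4 at v1 v2 a4
  rw [exists_stable_iff_not_conflict hR fun x => hsurj x _ (l2 x)] at v1
  by_cases hex : ∃ m, Stable R m ∧ ∀ x, R x (m x) = upper n s2 x
  · left
    rw [den_ite_of_eq (e := .var 10) (by exact v1.2 hex)]
    obtain ⟨m, hm, hmr⟩ := hex
    refine ⟨m, hm, ?_⟩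
    have o0 : (Cmd.seq (.assign 1 (.const 0) (.add numAgents (.const 1)))
        (.assign 1 (.const 1) (.const 1))).den s4 1 0 = n + 1 := by
      simp [Cmd.den, Store.write_apply, Term.eval, a4]
    have o1 : (Cmd.seq (.assign 1 (.const 0) (.add numAgents (.const 1)))
        (.assign 1 (.const 1) (.const 1))).den s4 1 1 = 1 := by
      simp [Cmd.den, Store.write_apply, Term.eval]
    have o2 : ∀ a : Fin n, (Cmd.seq (.assign 1 (.const 0) (.add numAgents (.const 1)))
        (.assign 1 (.const 1) (.const 1))).den s4 1 (a + 2) =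
          (partnerOf m a).elim 0 fun b => (b : ℕ) + 1 := by
      intro a
      have : (partnerOf m a).elim 0 (fun b => (b : ℕ) + 1) =
          if m a = a then 0 else (m a : ℕ) + 1 := by
        unfold partnerOf
        split_ifs <;> rfl
      rw [this, ← v2 a (m a) (hmr a)]
      simp [Cmd.den, Store.write_apply, Term.eval]
    unfold output
    rw [o0]
    refine List.ext_getElem (by simp) fun i h1 h2 => ?_
    rcases i with _ | i
    · simpa using o1
    · have hi : i < n := by simpa using h2
      simpa using o2 ⟨i, hi⟩
  · right
    rw [den_ite_of_ne (e := .var 10) (by exact mt v1.1 hex)]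
    refine ⟨fun m hm => hex (e2 ⟨m, hm⟩), ?_⟩
    have o0 : (Cmd.seq (.assign 1 (.const 0) (.const 1))
        (.assign 1 (.const 1) (.const 0))).den s4 1 0 = 1 := by
      simp [Cmd.den, Store.write_apply, Term.eval]
    have o1 : (Cmd.seq (.assign 1 (.const 0) (.const 1))
        (.assign 1 (.const 1) (.const 0))).den s4 1 1 = 0 := by
      simp [Cmd.den, Store.write_apply, Term.eval]
    unfold output
    rw [o0]
    simpa using o1

end RAM.Solver

/-! ### Computing the strict ranks -/

/-- The rank of an element is the number of smaller elements. -/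
theorem Finset.card_filter_lt_iff (n : ℕ) (g : ℕ → ℕ) {y z : ℕ} (hy : y < n) :
    ((range n).filter fun a => g a < g y).card < ((range n).filter fun a => g a < g z).card ↔
      g y < g z := by
  have mono : ∀ y z, g y ≤ g z →
      ((range n).filter fun a => g a < g y).card ≤ ((range n).filter fun a => g a < g z).card :=
    fun y z h => card_le_card fun a ha => by
      rw [mem_filter] at ha ⊢
      exact ⟨ha.1, ha.2.trans_le h⟩
  refine ⟨fun h => ?_, fun h => card_lt_card ⟨fun a ha => ?_, fun hs => ?_⟩⟩
  · by_contra hn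
    exact absurd (mono z y (not_lt.1 hn)) (not_le.2 h)
  · rw [mem_filter] at ha ⊢
    exact ⟨ha.1, ha.2.trans h⟩
  · have := hs (mem_filter.2 ⟨mem_range.2 hy, h⟩)
    exact lt_irrefl _ (mem_filter.1 this).2

namespace RAM.Solver

open Cmd StrictRoommates RefinedTypedInstance

/-- Repeated addition replaces the missing multiplication. By `hw` the row width depends on the
input bank only, so its value is the same in every round. -/
theorem offsets_spec {s : Store} {width : Term} {W : ℕ}
    (hw : ∀ s', s' 0 = s 0 → width.eval s' = W) (h11 : s 11 0 = 0) (h12 : s 12 0 = 0) :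
    ∀ x ≤ s 0 0, (offsets width).den s 11 x = x * s 0 0 ∧ (offsets width).den s 12 x = x * W := by
  refine den_loop_of_invariant' (by simp [Cmd.WF, Cmd.writes]) s
    (fun k s' => ∀ x ≤ k, s' 11 x = x * s 0 0 ∧ s' 12 x = x * W) (fun k s' x hk => ?_)
    (fun x hx => ?_) (fun j s' hj h1 h2 hf x hx => ?_)
  · simpa [Store.write_apply] using hk
  · obtain rfl : x = 0 := Nat.le_zero.1 hx
    simp [h11, h12]
  · have h0 : s' 0 = s 0 := hf 0 (by simp [Cmd.writes])
    have hw' : width.eval (s'.write 11 (j + 1) (j * s 0 0 + s 0 0)) = W :=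
      hw _ (by rw [Store.write_of_ne _ (by decide), h0])
    obtain ⟨h3, h4⟩ := h1 j le_rfl
    simp only [Cmd.den, Term.eval, h2, h3, h0, hw']
    rcases Nat.le_succ_iff_eq_or_le.1 hx with rfl | hx
    · simp [Store.write_apply, h2, h4, Nat.succ_mul]
    · have : x ≠ j + 1 := by omega
      simpa [Store.write_apply, this, h2] using h1 x hx

theorem keys_spec {n N : ℕ} {s : Store} (h0 : s 0 0 = N) (hn : n < N)
    (h11 : ∀ x < N, s 11 x = x * N) {rk : Term} {r : Fin n → Fin n → ℕ}
    (hrk : ∀ (x y : Fin n) (s' : Store), s' 0 = s 0 → s' 12 = s 12 → s' 2 0 = x → s' 3 0 = y →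
      rk.eval s' = r x y) (x y : Fin n) :
    (keys rk).den s 13 (x * N + y) =
      if y = x then N else if r x y = 0 then N + 1 else r x y := by
  have main := den_loop_loop_of_invariant (v := 2) (w := 3)
    (p := .ite (dist (.var 2) (.var 3))
      (.ite rk (.assign 13 (.add (.cell 11 (.var 2)) (.var 3)) rk)
        (.assign 13 (.add (.cell 11 (.var 2)) (.var 3)) (.add (.var 0) (.const 1))))
      (.assign 13 (.add (.cell 11 (.var 2)) (.var 3)) (.var 0)))
    (by simp [Cmd.WF, Cmd.writes]) s
    (fun k s' => ∀ x y : Fin n, x * N + y < k → s' 13 (x * N + y) =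
      if y = x then N else if r x y = 0 then N + 1 else r x y)
    (fun k s' x hk => by simpa [Store.write_apply] using hk)
    (fun k s' x hk => by simpa [Store.write_apply] using hk) (by simp)
    (fun x y s' hx hy h1 h2 h3 hf => ?_)
  · refine main x y ?_
    rw [h0]
    have := x.2.trans hn
    have := y.2.trans hn
    nlinarith
  · rw [h0] at hx hy h1 ⊢
    have f0 : s' 0 = s 0 := hf 0 (by simp [Cmd.writes])
    have f11 : s' 11 = s 11 := hf 11 (by simp [Cmd.writes])
    have f12 : s' 12 = s 12 := hf 12 (by simp [Cmd.writes])
    have hden : (Cmd.ite (dist (.var 2) (.var 3))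
        (.ite rk (.assign 13 (.add (.cell 11 (.var 2)) (.var 3)) rk)
          (.assign 13 (.add (.cell 11 (.var 2)) (.var 3)) (.add (.var 0) (.const 1))))
        (.assign 13 (.add (.cell 11 (.var 2)) (.var 3)) (.var 0))).den s' =
        s'.write 13 (x * N + y)
          (if y = x then N else if rk.eval s' = 0 then N + 1 else rk.eval s') := by
      have hd : (dist (.var 2) (.var 3)).eval s' = x - y + (y - x) := by
        simp [Term.eval, h2, h3]
      by_cases hxy : y = x
      · rw [den_ite_of_eq (by omega), if_pos hxy]
        simp [Cmd.den, Term.eval, h2, h3, f0, f11, h11 x hx, h0]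
      · rw [den_ite_of_ne (by omega), if_neg hxy]
        by_cases hr : rk.eval s' = 0
        · rw [den_ite_of_eq hr, if_pos hr]
          simp [Cmd.den, Term.eval, h2, h3, f0, f11, h11 x hx, h0]
        · rw [den_ite_of_ne hr, if_neg hr]
          simp [Cmd.den, Term.eval, h2, h3, f11, h11 x hx]
    rw [hden]
    intro a b hab
    rw [Store.write_apply]
    by_cases hab' : (a : ℕ) * N + b = x * N + y
    · obtain ⟨ha, hb⟩ := Nat.mul_add_inj (b.2.trans hn) hy hab'
      rw [if_pos ⟨rfl, hab'⟩, hrk a b s' f0 f12 (by rw [h2, ha]) (by rw [h3, hb])]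
      simp only [Fin.ext_iff, ha, hb]
    · rw [if_neg fun h => hab' h.2]
      exact h1 a b (by omega)

/-- The key of candidate `z` for agent `x`, with ties broken by the index. -/
def tieKey (N : ℕ) (t : ℕ → ℕ) (x z : ℕ) : ℕ := t (x * N + z) * N + z

/-- The machine never forms `tieKey`, which would require a product; it compares the keys and the
indices directly. -/
theorem countBefore_spec {n N : ℕ} {s : Store} (h0 : s 0 0 = N) (hn : s 0 1 = n) (hnN : n < N)
    {x y : ℕ} (hy : y < N) (h2 : s 2 0 = x) (h3 : s 3 0 = y) (h11 : s 11 x = x * N)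
    (h14 : s 14 (x * N + y) = 0) :
    countBefore.den s 14 = Function.update (s 14) (x * N + y)
      ((Finset.range n).filter fun z => tieKey N (s 13) x z < tieKey N (s 13) x y).card := by
  set P : ℕ → Prop := fun z => z < n ∧ tieKey N (s 13) x z < tieKey N (s 13) x y with hP
  have main := den_loop_of_invariant' (v := 4)
    (p := .ite (.sub numAgents (.var 4))
      (.ite (.sub (.add (entry 13 (.var 2) (.var 3))
          (.sub (.const 1) (.sub (.const 1) (.sub (.var 3) (.var 4)))))
          (entry 13 (.var 2) (.var 4)))
        (.assign 14 (.add (.cell 11 (.var 2)) (.var 3))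
          (.add (entry 14 (.var 2) (.var 3)) (.const 1)))
        .skip)
      .skip) (by simp [Cmd.WF, Cmd.writes]) s
    (fun k s' => s' 14 = Function.update (s 14) (x * N + y) ((Finset.range k).filter P).card)
    (fun k s' x hk => by rwa [Store.write_of_ne _ (by decide)])
    (by rw [Finset.range_zero, Finset.filter_empty, Finset.card_empty, ← h14,
      Function.update_eq_self])
    (fun j s' hj h1 h4 hf => ?_)
  · have e : (Finset.range (s 0 0)).filter P =
        (Finset.range n).filter fun z => tieKey N (s 13) x z < tieKey N (s 13) x y := by
      ext z
      simp only [hP, Finset.mem_filter, Finset.mem_range, h0]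
      constructor
      · exact fun h => h.2
      · exact fun h => ⟨h.1.trans hnN, h⟩
    rw [← e]
    exact main
  · rw [h0] at hj
    have f0 : s' 0 = s 0 := hf 0 (by simp [Cmd.writes])
    have f2 : s' 2 = s 2 := hf 2 (by simp [Cmd.writes])
    have f3 : s' 3 = s 3 := hf 3 (by simp [Cmd.writes])
    have f11 : s' 11 = s 11 := hf 11 (by simp [Cmd.writes])
    have f13 : s' 13 = s 13 := hf 13 (by simp [Cmd.writes])
    have e1 : (Term.sub numAgents (.var 4)).eval s' = n - j := by
      simp [Term.eval, f0, hn, h4]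
    have e2 : (Term.sub (.add (entry 13 (.var 2) (.var 3))
          (.sub (.const 1) (.sub (.const 1) (.sub (.var 3) (.var 4)))))
          (entry 13 (.var 2) (.var 4))).eval s' =
        s 13 (x * N + y) + (1 - (1 - (y - j))) - s 13 (x * N + j) := by
      simp [Term.eval, f2, f3, f11, f13, h2, h3, h4, h11]
    -- The nested truncated difference is `1` if `j < y` and `0` otherwise. Adding it to the left
    -- key turns the comparison into a strict one that accepts equal keys exactly for smaller
    -- indices.
    have key : s 13 (x * N + y) + (1 - (1 - (y - j))) - s 13 (x * N + j) ≠ 0 ↔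
        tieKey N (s 13) x j < tieKey N (s 13) x y := by
      unfold tieKey
      rcases lt_trichotomy (s 13 (x * N + j)) (s 13 (x * N + y)) with h5 | h5 | h5
      · have := Nat.mul_add_lt_of_lt (d := y) hj h5
        omega
      · rw [h5]; omega
      · have := Nat.mul_add_lt_of_lt (d := j) hy h5
        have : ¬ (s 13 (x * N + j) * N + j < s 13 (x * N + y) * N + y) := by omega
        simp only [this, iff_false, not_not]
        omega
    rw [Finset.range_add_one, Finset.filter_insert]
    by_cases hjn : j < n
    · rw [den_ite_of_ne (by omega)]
      by_cases hb : tieKey N (s 13) x j < tieKey N (s 13) x y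
      · rw [den_ite_of_ne (by rw [e2]; exact key.2 hb), if_pos (by exact ⟨hjn, hb⟩),
          Finset.card_insert_of_notMem (by simp)]
        simp only [Cmd.den, Term.eval, f2, f3, f11, h2, h3, h11]
        rw [Store.write_self, h1, Function.update_self, Function.update_idem]
      · rw [den_ite_of_eq (by rw [e2]; exact not_not.1 (mt key.1 hb)),
          if_neg (fun h => hb h.2)]
        exact h1
    · rw [den_ite_of_eq (by omega), if_neg (fun h => hjn h.1)]
      exact h1

theorem strictRanks_spec {n N : ℕ} {s : Store} (h0 : s 0 0 = N) (hn : s 0 1 = n) (hnN : n < N)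
    (h11 : ∀ x < N, s 11 x = x * N) (x y : Fin n) :
    strictRanks.den s 14 (x * N + y) =
      ((Finset.range n).filter fun z => tieKey N (s 13) x z < tieKey N (s 13) x y).card := by
  have main := den_loop_loop_of_invariant (v := 2) (w := 3)
    (p := .seq (.assign 14 (.add (.cell 11 (.var 2)) (.var 3)) (.const 0)) countBefore)
    (by simp [countBefore, Cmd.WF, Cmd.writes]) s
    (fun k s' => ∀ x y : Fin n, x * N + y < k → s' 14 (x * N + y) =
      ((Finset.range n).filter fun z => tieKey N (s 13) x z < tieKey N (s 13) x y).card)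
    (fun k s' x hk => by simpa [Store.write_apply] using hk)
    (fun k s' x hk => by simpa [Store.write_apply] using hk) (by simp)
    (fun x y s' hx hy h1 h2 h3 hf => ?_)
  · refine main x y ?_
    rw [h0]
    have := x.2.trans hnN
    have := y.2.trans hnN
    nlinarith
  · rw [h0] at hx hy h1 ⊢
    have f0 : s' 0 = s 0 := hf 0 (by simp [countBefore, Cmd.writes])
    have f11 : s' 11 = s 11 := hf 11 (by simp [countBefore, Cmd.writes])
    have f13 : s' 13 = s 13 := hf 13 (by simp [countBefore, Cmd.writes])
    have hden : (Cmd.seq (.assign 14 (.add (.cell 11 (.var 2)) (.var 3)) (.const 0))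
        countBefore).den s' = countBefore.den (s'.write 14 (x * N + y) 0) := by
      simp [Cmd.den, Term.eval, h2, h3, f11, h11 x hx]
    rw [hden, countBefore_spec (x := x) (y := y) (by simp [Store.write_apply, f0, h0])
      (by simpa [Store.write_apply, f0] using hn) hnN hy (by simp [Store.write_apply, h2])
      (by simp [Store.write_apply, h3]) (by simp [Store.write_apply, f11, h11 x hx])
      (by simp [Store.write_apply])]
    rw [Store.write_self, Function.update_idem, Store.write_of_ne _ (by decide), f13]
    intro a b hab
    by_cases hab' : (a : ℕ) * N + b = x * N + y
    · obtain ⟨ha, hb⟩ := Nat.mul_add_inj (b.2.trans hnN) hy hab'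
      rw [hab', Function.update_self, ha, hb]
    · rw [Function.update_of_ne hab']
      exact h1 a b (by omega)

/-- The program solves every instance whose table of ranks is computed by the term `rk`. -/
theorem main_spec {n N W : ℕ} {T : Type*} {I : RefinedTypedInstance (Fin n) T}
    (hst : I.StrictOverTypes) {r : T → Fin n → ℕ}
    (hacc : ∀ i x, r i x = 0 ↔ ¬ (I.pref i).acc x)
    (hlt : ∀ i x y, (I.pref i).strict x y → r i x < r i y) (hrN : ∀ i x, r i x < N)
    {s : Store} (h0 : s 0 0 = N) (hn : s 0 1 = n) (hnN : n < N) (hs : ∀ b ≠ 0, ∀ i, s b i = 0)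
    {width rk : Term} (hw : ∀ s', s' 0 = s 0 → width.eval s' = W)
    (hrk : ∀ (x y : Fin n) (s' : Store), s' 0 = s 0 → (∀ a ≤ N, s' 12 a = a * W) → s' 2 0 = x →
      s' 3 0 = y → rk.eval s' = r (I.typ x) y) :
    I.toSRTI.IsMaxStableAnswer (output ((main width rk).den s)) := by
  simp only [main, den_seq]
  have c1 := offsets_spec hw (hs 11 (by decide) 0) (hs 12 (by decide) 0)
  have f1 : (offsets width).den s 0 = s 0 :=
    den_of_notMem_writes _ _ (by simp [offsets, Cmd.writes])
  rw [h0] at c1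
  generalize (offsets width).den s = s1 at c1 f1
  have c2 := keys_spec (n := n) (N := N) (s := s1) (rk := rk) (r := fun x y => r (I.typ x) y)
    (by rw [f1, h0]) hnN (fun x hx => (c1 x hx.le).1)
    (fun x y s' g0 g12 g2 g3 => hrk x y s' (by rw [g0, f1])
      (fun a ha => by rw [g12, (c1 a ha).2]) g2 g3)
  have f2 : (keys rk).den s1 0 = s 0 := by
    rw [den_of_notMem_writes _ _ (by simp [keys, Cmd.writes]), f1]
  have o2 : ∀ x < N, (keys rk).den s1 11 x = x * N := fun x hx => by
    rw [den_of_notMem_writes _ _ (by simp [keys, Cmd.writes]), (c1 x hx.le).1]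
  generalize (keys rk).den s1 = s2 at c2 f2 o2
  have c3 := strictRanks_spec (n := n) (N := N) (s := s2) (by rw [f2, h0]) (by rw [f2, hn]) hnN o2
  set R : Fin n → Fin n → ℕ := fun x y =>
    ((Finset.range n).filter fun z => tieKey N (s2 13) x z < tieKey N (s2 13) x y).card with hRdef
  have t3 : Tables n N R (strictRanks.den s2) := by
    have f3 : strictRanks.den s2 0 = s 0 := by
      rw [den_of_notMem_writes _ _ (by simp [strictRanks, countBefore, Cmd.writes]), f2]
    refine ⟨by rw [f3, h0], by rw [f3, hn], hnN, fun x hx => ?_, c3⟩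
    rw [den_of_notMem_writes _ _ (by simp [strictRanks, countBefore, Cmd.writes]), o2 x hx]
  generalize strictRanks.den s2 = s3 at c3 t3
  -- The row length `N` exceeds all ranks and all indices, so it serves both as the key of the agent
  -- itself and as the base of the tie-breaking.
  have hkey : ∀ x y : Fin n, tieKey N (s2 13) x y = tieBreak I.typ r Fin.val N N x y := by
    intro x y
    unfold tieKey tieBreak
    rw [c2]
  have hbreak := breaksTies_of_tieBreak (I := I) (idx := Fin.val) (R := R) hacc hlt hrN
    (fun x => x.2.trans hnN) Fin.val_injective (fun a b c => by
      rw [← hkey, ← hkey]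
      exact Finset.card_filter_lt_iff n (tieKey N (s2 13) a) b.2)
  have hRn : ∀ x y, R x y < n := by
    intro x y
    have : ((Finset.range n).filter fun z => tieKey N (s2 13) x z < tieKey N (s2 13) x y).card <
        (Finset.range n).card := by
      refine Finset.card_lt_card (Finset.filter_ssubset.2 ⟨y, Finset.mem_range.2 y.2, ?_⟩)
      exact lt_irrefl _
    rwa [Finset.card_range] at this
  rcases solve_spec hbreak.inj hRn t3 with ⟨m, hm, ho⟩ | ⟨hno, ho⟩
  · exact Or.inl ⟨_, hbreak.isMaxStable_partnerOf hst hm, ho⟩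
  · refine Or.inr ⟨fun M hM => ?_, ho⟩
    obtain ⟨m, hm, _⟩ := hbreak.exists_stable hst hM
    exact hno m hm

end RAM.Solver

/-! ### Layout of the input word -/

namespace RAM

theorem getD_flatten_of_length_eq {c : ℕ} : ∀ (L : List (List ℕ)) (_ : ∀ l ∈ L, l.length = c)
    {i j : ℕ} (_ : j < c), L.flatten.getD (i * c + j) 0 = (L.getD i []).getD j 0
  | [], _, _, _, _ => by simp
  | l :: L, h, 0, j, hj => by
    have hl : j < l.length := by rw [h l (by simp)]; exact hj
    simp [List.getElem?_append_left hl]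
  | l :: L, h, i + 1, j, hj => by
    have hl : l.length = c := h l (by simp)
    have := getD_flatten_of_length_eq L (fun l' hl' => h l' (List.mem_cons_of_mem _ hl'))
      (i := i) hj
    rw [List.flatten_cons, List.getD_append_right _ _ _ _ (by rw [hl, Nat.succ_mul]; omega), hl]
    rw [show (i + 1) * c + j - c = i * c + j by rw [Nat.succ_mul]; omega, this]
    simp

/-- The input word that consists of `n`, `k`, a list of types and a table of ranks. -/
def word (n k : ℕ) {c : ℕ} (t : Fin n → ℕ) (r : Fin k → Fin c → ℕ) : List ℕ :=
  n :: k :: (List.ofFn t ++ (List.ofFn fun i => List.ofFn (r i)).flatten)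

section

variable {n k c : ℕ} {t : Fin n → ℕ} {r : Fin k → Fin c → ℕ}

theorem length_word : (word n k t r).length = n + k * c + 2 := by
  simp only [word, List.length_cons, List.length_append, List.length_ofFn, List.length_flatten,
    List.map_ofFn, List.sum_ofFn, Function.comp_def, Finset.sum_const, Finset.card_univ,
    Fintype.card_fin, smul_eq_mul]

theorem initStore_word_length : initStore (word n k t r) 0 0 = n + k * c + 2 := by
  rw [← length_word (t := t) (r := r)]
  rfl

/-- Cells `0`, `1` and `2` hold the length, `n` and `k`, so the types start at cell `3` and the
table of ranks at cell `3 + n`. -/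
theorem initStore_word_typ (a : Fin n) : initStore (word n k t r) 0 (a + 3) = t a := by
  have h : (a : ℕ) < (List.ofFn t).length := by simp
  simp [initStore, word, List.getElem?_append_left h]

theorem initStore_word_rank (i : Fin k) (j : Fin c) :
    initStore (word n k t r) 0 (3 + n + (i * c + j)) = r i j := by
  have h := getD_flatten_of_length_eq (c := c) (List.ofFn fun i => List.ofFn (r i))
    (by simp) (i := i) j.2
  have e : 3 + n + ((i : ℕ) * c + j) = (n + (i * c + j)) + 3 := by omega
  rw [e]
  have e2 : initStore (word n k t r) 0 ((n + (i * c + j)) + 3) =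
      (List.ofFn t ++ (List.ofFn fun i => List.ofFn (r i)).flatten).getD (n + (i * c + j)) 0 := rfl
  rw [e2, List.getD_append_right _ _ _ _ (by simp), List.length_ofFn, Nat.add_sub_cancel_left, h]
  simp

end

end RAM

/-! ### Assembling the results -/

theorem mainTheorem6 :
    RAM.PolyTimeSolvable (fun x : TypedInput => x.inst.StrictOverTypes)
      TypedInput.encode (fun x v => x.inst.toSRTI.IsMaxStableAnswer v) ∧
    RAM.PolyTimeSolvable (fun x : RefinedTypedInput => x.inst.StrictOverTypes)
      RefinedTypedInput.encode (fun x v => x.inst.toSRTI.IsMaxStableAnswer v) ∧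
    (∀ (A T : Type*) [Finite A] (I : TypedInstance A T), I.StrictOverTypes →
      ∀ M M', I.toSRTI.IsStable M → I.toSRTI.IsStable M' → matchingSize M = matchingSize M') ∧
    (∀ (A T : Type*) [Finite A] (I : RefinedTypedInstance A T), I.StrictOverTypes →
      ∀ M M', I.toSRTI.IsStable M → I.toSRTI.IsStable M' → matchingSize M = matchingSize M') := by
  refine ⟨?_, ?_, fun A T _ I hst M M' hM hM' => ?_, fun A T _ I hst M M' hM hM' => ?_⟩
  -- Rows of the table have width `k`; row and column are the types of the agents in the two loop
  -- counters, read from the input.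
  · refine RAM.PolyTimeSolvable.of_cmd (RAM.Solver.main (.cell 0 (.const 2))
      (.cell 0 (.add (.add (.const 3) RAM.Solver.numAgents)
        (.add (.cell 12 (.cell 0 (.add (.var 2) (.const 3))))
          (.cell 0 (.add (.var 3) (.const 3))))))) (RAM.Solver.wf_main _ _) fun x hx => ?_
    have hw : x.encode = RAM.word x.n x.k (fun a => (x.inst.typ a : ℕ))
      (fun i j => (x.inst.pref i).rank j) := rfl
    rw [hw]
    -- Ensures that the length of the word exceeds every rank, which is at most `k + 1`, and that
    -- the offset of every type has been computed.
    have hkk : x.k ≤ x.k * x.k := Nat.le_mul_self _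
    refine RAM.Solver.main_spec (I := x.inst.toRefined) (N := x.n + x.k * x.k + 2) (W := x.k)
      (r := fun i a => (x.inst.pref i).rank (x.inst.typ a)) hx.toRefined
      (fun i a => (x.inst.pref i).rank_eq_zero_iff) (fun i a b h => (x.inst.pref i).rank_lt_rank h)
      (fun i a => ?_) RAM.initStore_word_length rfl (by omega) (fun b hb i => if_neg hb)
      (fun s' h => congrFun h 2) fun a b s' h0 h12 h2 h3 => ?_
    · have := (x.inst.pref i).rank_le_card (x.inst.typ a)
      rw [Nat.card_fin] at this
      omega
    · have ht := (x.inst.typ a).2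
      simp only [RAM.Term.eval, h0, h2, h3, RAM.initStore_word_typ]
      rw [h12 _ (by omega)]
      exact RAM.initStore_word_rank _ _
  · refine RAM.PolyTimeSolvable.of_cmd (RAM.Solver.main (.cell 0 (.const 1))
      (.cell 0 (.add (.add (.const 3) RAM.Solver.numAgents)
        (.add (.cell 12 (.cell 0 (.add (.var 2) (.const 3)))) (.var 3)))))
      (RAM.Solver.wf_main _ _) fun x hx => ?_
    have hw : x.encode = RAM.word x.n x.k (fun a => (x.inst.typ a : ℕ))
      (fun i j => (x.inst.pref i).rank j) := rfl
    rw [hw]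
    have hrank : ∀ (i : Fin x.k) (a : Fin x.n),
        (x.inst.pref i).rank a < x.n + x.k * x.n + 2 := fun i a => by
      have := (x.inst.pref i).rank_le_card a
      rw [Nat.card_fin] at this
      omega
    refine RAM.Solver.main_spec (I := x.inst) (N := x.n + x.k * x.n + 2) (W := x.n)
      (r := fun i => (x.inst.pref i).rank) hx
      (fun i a => (x.inst.pref i).rank_eq_zero_iff) (fun i a b => (x.inst.pref i).rank_lt_rank)
      hrank RAM.initStore_word_length rfl (by omega) (fun b hb i => if_neg hb)
      (fun s' h => congrFun h 1) fun a b s' h0 h12 h2 h3 => ?_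
    have ht := (x.inst.typ a).2
    have hn := a.2
    -- There is an agent `a`, so `n` is positive; hence the type index does not exceed the length of
    -- the word and its offset is available.
    have hle : x.k ≤ x.k * x.n := Nat.le_mul_of_pos_right _ (by omega)
    simp only [RAM.Term.eval, h0, h2, h3, RAM.initStore_word_typ]
    rw [h12 _ (by omega)]
    exact RAM.initStore_word_rank _ _
  · exact RefinedTypedInstance.matchingSize_eq_of_isStable hst.toRefined hM hM'
  · exact RefinedTypedInstance.matchingSize_eq_of_isStable hst hM hM'
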